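/- All graphs are finite and simple. A tree decomposition of a graph $G$ is a tree $T$ together with a set (bag) $X_t\subseteq V(G)$ for every node $t$ of $T$, such that every vertex of $G$ lies in some bag, both ends of every edge of $G$ lie together in some bag, and for every vertex $v$ the nodes $t$ with $v\in X_t$ induce a connected subtree of $T$. It is *$k$-almost chordal* if every bag can be made a clique by adding at most $k$ edges, that is, every $G[X_t]$ has at most $k$ pairs of distinct non-adjacent vertices. It is *nice* if $T$ is rooted, the bags of the root and of all leaves (nodes without children) are empty, and every other node $t$ either has exactly one child $t'$ and $X_t=X_{t'}\cup\{v\}$ for some $v\notin X_{t'}$, or has exactly one child $t'$ and $X_t=X_{t'}\setminus\{v\}$ for some $v\in X_{t'}$, or has exactly two children $t_1,t_2$ and $X_t=X_{t_1}=X_{t_2}$. In *Weighted $d$-colorable Subgraph* one is given a graph $G$ with weights $w\colon V(G)\to\mathbb R$ and has to find a set $S\subseteq V(G)$, possibly empty, such that $G[S]$ is $d$-colorable and $\sum_{v\in S}w(v)$ is maximum. Time is measured on a random access machine with unit cost, on which natural numbers can be added, subtracted, compared and used as addresses, and real numbers (the weights) can be added, subtracted and compared. **Theorem.** There is an algorithm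 which, given an integer $d\ge 1$, a graph $G$ on $n\geq 1$ vertices with real vertex weights, and a nice tree decomposition of $G$, solves Weighted $d$-colorable Subgraph, with the following running time. If the decomposition is $k$-almost chordal and has $n^{\mathcal O(1)}$ bags, then the running time is $$2^{\mathcal O(\sqrt k\cdot d\log (d+1))}\cdot n^{\mathcal O(d)}.$$ In detail: for every $c$ there is a constant $C$, depending on $c$ only and not on $d$, $k$, $n$ or the input, such that if the decomposition is $k$-almost chordal and has at most $c\,n^{c}$ bags, then the algorithm halts with an optimal set $S$ after at most $C\cdot 2^{C\sqrt k\, d\log_2 (d+1)}\cdot n^{Cd}$ steps. -/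

import Mathlib

noncomputable section

/-! ### A random access machine with unit cost arithmetic

Programs work on natural numbers and on real numbers, which are kept apart.  Naturals can be added,
subtracted (truncated at `0`), compared and used as addresses; they cannot be multiplied, so that
unit cost is polynomially equivalent to bit cost.  Reals (the weights) can only be added,
subtracted and compared.  Every operation costs one step. -/

namespace RAM

/-- A memory: scalar variables and arrays of naturals, scalar variables and arrays of reals.
A program mentions only finitely many variables and arrays. -/
structure State where
  nvar : ℕ → ℕ
  narr : ℕ → ℕ → ℕ
  rvar : ℕ → ℝ
  rarr : ℕ → ℕ → ℝ

/-- Expressions of type natural number; `get a i` is the entry `a[i]`. -/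
inductive NExp where
  | lit (c : ℕ)
  | var (x : ℕ)
  | get (a : ℕ) (i : NExp)
  | add (e f : NExp)
  | sub (e f : NExp)

def NExp.eval (s : State) : NExp → ℕ
  | .lit c => c
  | .var x => s.nvar x
  | .get a i => s.narr a (i.eval s)
  | .add e f => e.eval s + f.eval s
  | .sub e f => e.eval s - f.eval s

/-- The number of operations in the evaluation of an expression. -/
def NExp.cost : NExp → ℕ
  | .lit _ => 1
  | .var _ => 1
  | .get _ i => i.cost + 1
  | .add e f => e.cost + f.cost + 1
  | .sub e f => e.cost + f.cost + 1

/-- Expressions of type real number; the only real constant is `0`. -/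
inductive RExp where
  | zero
  | var (x : ℕ)
  | get (a : ℕ) (i : NExp)
  | add (e f : RExp)
  | sub (e f : RExp)

def RExp.eval (s : State) : RExp → ℝ
  | .zero => 0
  | .var x => s.rvar x
  | .get a i => s.rarr a (i.eval s)
  | .add e f => e.eval s + f.eval s
  | .sub e f => e.eval s - f.eval s

def RExp.cost : RExp → ℕ
  | .zero => 1
  | .var _ => 1
  | .get _ i => i.cost + 1
  | .add e f => e.cost + f.cost + 1
  | .sub e f => e.cost + f.cost + 1

/-- Tests. -/
inductive BExp where
  | nle (e f : NExp)
  | neq (e f : NExp)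
  | rle (e f : RExp)
  | not (b : BExp)
  | and (b c : BExp)

def BExp.Holds (s : State) : BExp → Prop
  | .nle e f => e.eval s ≤ f.eval s
  | .neq e f => e.eval s = f.eval s
  | .rle e f => e.eval s ≤ f.eval s
  | .not b => ¬ b.Holds s
  | .and b c => b.Holds s ∧ c.Holds s

def BExp.cost : BExp → ℕ
  | .nle e f => e.cost + f.cost + 1
  | .neq e f => e.cost + f.cost + 1
  | .rle e f => e.cost + f.cost + 1
  | .not b => b.cost + 1
  | .and b c => b.cost + c.cost + 1

/-- Programs: assignments to scalars and to array entries, composition, branching, while loops. -/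
inductive Prog where
  | skip
  | setN (x : ℕ) (e : NExp)
  | putN (a : ℕ) (i e : NExp)
  | setR (x : ℕ) (e : RExp)
  | putR (a : ℕ) (i : NExp) (e : RExp)
  | seq (p q : Prog)
  | ite (b : BExp) (p q : Prog)
  | loop (b : BExp) (p : Prog)

def State.setN (s : State) (x v : ℕ) : State :=
  { s with nvar := Function.update s.nvar x v }

def State.putN (s : State) (a i v : ℕ) : State :=
  { s with narr := Function.update s.narr a (Function.update (s.narr a) i v) }

def State.setR (s : State) (x : ℕ) (v : ℝ) : State :=
  { s with rvar := Function.update s.rvar x v }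

def State.putR (s : State) (a i : ℕ) (v : ℝ) : State :=
  { s with rarr := Function.update s.rarr a (Function.update (s.rarr a) i v) }

/-- `Exec p s t s'`: the program `p`, started in the memory `s`, halts after exactly `t` steps,
and the memory is then `s'`. -/
inductive Exec : Prog → State → ℕ → State → Prop where
  | skip (s : State) : Exec .skip s 1 s
  | setN (x : ℕ) (e : NExp) (s : State) :
      Exec (.setN x e) s (e.cost + 1) (s.setN x (e.eval s))
  | putN (a : ℕ) (i e : NExp) (s : State) :
      Exec (.putN a i e) s (i.cost + e.cost + 1) (s.putN a (i.eval s) (e.eval s))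
  | setR (x : ℕ) (e : RExp) (s : State) :
      Exec (.setR x e) s (e.cost + 1) (s.setR x (e.eval s))
  | putR (a : ℕ) (i : NExp) (e : RExp) (s : State) :
      Exec (.putR a i e) s (i.cost + e.cost + 1) (s.putR a (i.eval s) (e.eval s))
  | seq {p q : Prog} {s₁ s₂ s₃ : State} {t₁ t₂ : ℕ} :
      Exec p s₁ t₁ s₂ → Exec q s₂ t₂ s₃ → Exec (.seq p q) s₁ (t₁ + t₂) s₃
  | iteTrue {b : BExp} {p q : Prog} {s s' : State} {t : ℕ} :
      b.Holds s → Exec p s t s' → Exec (.ite b p q) s (b.cost + 1 + t) s'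
  | iteFalse {b : BExp} {p q : Prog} {s s' : State} {t : ℕ} :
      ¬ b.Holds s → Exec q s t s' → Exec (.ite b p q) s (b.cost + 1 + t) s'
  | loopTrue {b : BExp} {p : Prog} {s₁ s₂ s₃ : State} {t₁ t₂ : ℕ} :
      b.Holds s₁ → Exec p s₁ t₁ s₂ → Exec (.loop b p) s₂ t₂ s₃ →
        Exec (.loop b p) s₁ (b.cost + 1 + t₁ + t₂) s₃
  | loopFalse {b : BExp} {p : Prog} {s : State} :
      ¬ b.Holds s → Exec (.loop b p) s (b.cost + 1) s

end RAM

/-! ### Nice almost chordal tree decompositions -/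

/-- `T` with the bags `X t` is a tree decomposition of `G`. -/
structure IsTreeDecomposition {V ι : Type*} (G : SimpleGraph V) (T : SimpleGraph ι)
    (X : ι → Set V) : Prop where
  isTree : T.IsTree
  vertex_mem : ∀ v : V, ∃ t : ι, v ∈ X t
  edge_mem : ∀ u v : V, G.Adj u v → ∃ t : ι, u ∈ X t ∧ v ∈ X t
  connected : ∀ v : V, (T.induce {t : ι | v ∈ X t}).Connected

/-- In the tree `T` rooted at `r`, the node `s` is a child of the node `t`. -/
def IsChild {ι : Type*} (T : SimpleGraph ι) (r t s : ι) : Prop :=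
  T.Adj t s ∧ T.dist r s = T.dist r t + 1

def IsLeafNode {ι : Type*} (T : SimpleGraph ι) (r t : ι) : Prop :=
  ∀ s : ι, ¬ IsChild T r t s

def IsIntroduceNode {V ι : Type*} (T : SimpleGraph ι) (r : ι) (X : ι → Set V) (t : ι) : Prop :=
  ∃ t' : ι, (∀ s : ι, IsChild T r t s ↔ s = t') ∧ ∃ v : V, v ∉ X t' ∧ X t = X t' ∪ {v}

def IsForgetNode {V ι : Type*} (T : SimpleGraph ι) (r : ι) (X : ι → Set V) (t : ι) : Prop :=
  ∃ t' : ι, (∀ s : ι, IsChild T r t s ↔ s = t') ∧ ∃ v : V, v ∈ X t' ∧ X t = X t' \ {v}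

def IsJoinNode {V ι : Type*} (T : SimpleGraph ι) (r : ι) (X : ι → Set V) (t : ι) : Prop :=
  ∃ t₁ t₂ : ι, t₁ ≠ t₂ ∧ (∀ s : ι, IsChild T r t s ↔ s = t₁ ∨ s = t₂) ∧
    X t = X t₁ ∧ X t = X t₂

/-- The tree decomposition with tree `T` rooted at `r` and bags `X t` is nice. -/
structure IsNice {V ι : Type*} (T : SimpleGraph ι) (r : ι) (X : ι → Set V) : Prop where
  root_empty : X r = ∅
  leaf_empty : ∀ t : ι, IsLeafNode T r t → X t = ∅
  node_type : ∀ t : ι, ¬ IsLeafNode T r t →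
    IsIntroduceNode T r X t ∨ IsForgetNode T r X t ∨ IsJoinNode T r X t

/-- The number of edges whose addition turns the finite graph `H` into a complete graph. -/
def cliqueCompletionSize {V : Type*} (H : SimpleGraph V) : ℕ :=
  ((⊤ : SimpleGraph V).edgeSet \ H.edgeSet).ncard

/-- Every bag can be made a clique of `G` by adding at most `k` edges. -/
def IsAlmostChordal {V ι : Type*} (k : ℕ) (G : SimpleGraph V) (X : ι → Set V) : Prop :=
  ∀ t : ι, cliqueCompletionSize (G.induce (X t)) ≤ k

/-! ### The problem Weighted `d`-colorable Subgraph -/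

/-- `S` induces a `d`-colorable subgraph of `G`, and its weight is maximum among all vertex sets
that do so. -/
def IsMaxWeightColorable {V : Type*} (d : ℕ) (G : SimpleGraph V) (w : V → ℝ)
    (S : Finset V) : Prop :=
  (G.induce (S : Set V)).Colorable d ∧
    ∀ S' : Finset V, (G.induce (S' : Set V)).Colorable d → ∑ v ∈ S', w v ≤ ∑ v ∈ S, w v

open Classical in
/-- The `0`-`1` matrix of a relation, stored row by row. -/
def matrixOf {a b : ℕ} (R : Fin a → Fin b → Prop) : ℕ → ℕ :=
  fun m => if ∃ (i : Fin a) (j : Fin b), R i j ∧ m = (i : ℕ) * b + j then 1 else 0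

/-- The input memory.  The variables `0, 1, 2, 3` hold `d`, the number `n` of vertices, the number
`N` of nodes and the root; array `0` holds the adjacency matrix of the graph, array `1` the
matrix of the relation "`s` is a child of `t`", array `2` the matrix of the relation "the bag of `t`
contains `v`", and real array `0` the weights.  Everything else is `0`. -/
def inputState (d : ℕ) {n N : ℕ} (G : SimpleGraph (Fin n)) (w : Fin n → ℝ)
    (T : SimpleGraph (Fin N)) (r : Fin N) (X : Fin N → Set (Fin n)) : RAM.State where
  nvar := fun x => match x with
    | 0 => d
    | 1 => n
    | 2 => N
    | 3 => r
    | _ => 0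
  narr := fun a => match a with
    | 0 => matrixOf G.Adj
    | 1 => matrixOf (IsChild T r)
    | 2 => matrixOf (fun t v => v ∈ X t)
    | _ => fun _ => 0
  rvar := fun _ => 0
  rarr := fun a i => if h : a = 0 ∧ i < n then w ⟨i, h.2⟩ else 0

/-- The output: the set of the vertices `v` whose entry in array `3` is `1`. -/
def outputSet (n : ℕ) (s : RAM.State) : Finset (Fin n) :=
  Finset.univ.filter (fun v => s.narr 3 v = 1)

end

/-! In a proper partial coloring of a bag every color class is independent, hence a clique of the
complement of the graph on that bag, which has at most `k` edges. A graph with `k` edges has few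
cliques: let `D` be `⌊√(2k)⌋ + 1`. At most `D` vertices have degree at least `D`, and a clique
either consists of such vertices or lies in the closed neighborhood, of size at most `D`, of a
vertex of smaller degree. This leaves at most `(n + 1) * 2 ^ D` cliques
(`SimpleGraph.card_cliques_le`). A coloring is determined by its `d` classes, so a bag has at most
the `d`-th power of this number of partial colorings (`card_partialColorings_le`).

The algorithm is dynamic programming over the pairs (node, partial coloring of its bag), called
items. Each item gets a heaviest coloring of the vertices below the node that extends it. A bag
separates the vertices below a child from the rest, so this extension is glued together, child by
child, from best extensions of compatible child items (`IsOptimalExtension.overlay`). The root bag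
is empty, and the extension of its empty coloring is the solution.

Steps are counted coarsely. One number `Z`, polynomial in `n`, the number of nodes and the number of
colorings per bag, bounds the rounds of every loop, so the time is at most a constant times `Z` to
the nesting depth of the fixed program; the constant `C` absorbs that exponent. First `d` is
replaced by `min d n`: for `n = 1` and `k = 0` the claimed bound does not grow with `d` at all. -/

namespace RAM

/-! ### A Hoare logic with running times -/

/-- The natural scalars that a program may assign. -/
def Prog.nvars : Prog → List ℕ
  | .setN x _ => [x]
  | .seq p q => p.nvars ++ q.nvars
  | .ite _ p q => p.nvars ++ q.nvars
  | .loop _ p => p.nvars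
  | _ => []

/-- The arrays of naturals that a program may modify. -/
def Prog.narrs : Prog → List ℕ
  | .putN a _ _ => [a]
  | .seq p q => p.narrs ++ q.narrs
  | .ite _ p q => p.narrs ++ q.narrs
  | .loop _ p => p.narrs
  | _ => []

/-- The real scalars that a program may assign. -/
def Prog.rvars : Prog → List ℕ
  | .setR x _ => [x]
  | .seq p q => p.rvars ++ q.rvars
  | .ite _ p q => p.rvars ++ q.rvars
  | .loop _ p => p.rvars
  | _ => []

/-- The arrays of reals that a program may modify. -/
def Prog.rarrs : Prog → List ℕ
  | .putR a _ _ => [a]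
  | .seq p q => p.rarrs ++ q.rarrs
  | .ite _ p q => p.rarrs ++ q.rarrs
  | .loop _ p => p.rarrs
  | _ => []

/-- The memories `s` and `s'` agree on everything that `p` does not write to. -/
structure Frame (p : Prog) (s s' : State) : Prop where
  nvar : ∀ x, x ∉ p.nvars → s'.nvar x = s.nvar x
  narr : ∀ a, a ∉ p.narrs → s'.narr a = s.narr a
  rvar : ∀ x, x ∉ p.rvars → s'.rvar x = s.rvar x
  rarr : ∀ a, a ∉ p.rarrs → s'.rarr a = s.rarr a

theorem Frame.refl (p : Prog) (s : State) : Frame p s s :=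
  ⟨fun _ _ => rfl, fun _ _ => rfl, fun _ _ => rfl, fun _ _ => rfl⟩

theorem Frame.trans {p : Prog} {s₁ s₂ s₃ : State} (h : Frame p s₁ s₂) (h' : Frame p s₂ s₃) :
    Frame p s₁ s₃ :=
  ⟨fun x hx => (h'.nvar x hx).trans (h.nvar x hx), fun x hx => (h'.narr x hx).trans (h.narr x hx),
    fun x hx => (h'.rvar x hx).trans (h.rvar x hx), fun x hx => (h'.rarr x hx).trans (h.rarr x hx)⟩

theorem Frame.mono {p q : Prog} {s s' : State} (h : Frame p s s') (h₁ : p.nvars ⊆ q.nvars)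
    (h₂ : p.narrs ⊆ q.narrs) (h₃ : p.rvars ⊆ q.rvars) (h₄ : p.rarrs ⊆ q.rarrs) : Frame q s s' :=
  ⟨fun x hx => h.nvar x fun h => hx (h₁ h), fun x hx => h.narr x fun h => hx (h₂ h),
    fun x hx => h.rvar x fun h => hx (h₃ h), fun x hx => h.rarr x fun h => hx (h₄ h)⟩

/-- Thanks to this, an invariant has to mention only what the loop body writes; everything else is
recovered by `decide` on the lists of written variables. -/
theorem Exec.frame {p : Prog} {s s' : State} {t : ℕ} (h : Exec p s t s') : Frame p s s' := by
  induction h with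
  | skip s => exact Frame.refl _ _
  | setN x e s =>
    refine ⟨fun y hy => ?_, fun _ _ => rfl, fun _ _ => rfl, fun _ _ => rfl⟩
    exact Function.update_of_ne (by simpa [Prog.nvars] using hy) _ _
  | putN a i e s =>
    refine ⟨fun _ _ => rfl, fun y hy => ?_, fun _ _ => rfl, fun _ _ => rfl⟩
    exact Function.update_of_ne (by simpa [Prog.narrs] using hy) _ _
  | setR x e s =>
    refine ⟨fun _ _ => rfl, fun _ _ => rfl, fun y hy => ?_, fun _ _ => rfl⟩
    exact Function.update_of_ne (by simpa [Prog.rvars] using hy) _ _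
  | putR a i e s =>
    refine ⟨fun _ _ => rfl, fun _ _ => rfl, fun _ _ => rfl, fun y hy => ?_⟩
    exact Function.update_of_ne (by simpa [Prog.rarrs] using hy) _ _
  | seq _ _ h₁ h₂ =>
    exact (h₁.mono (List.subset_append_left _ _) (List.subset_append_left _ _)
      (List.subset_append_left _ _) (List.subset_append_left _ _)).trans
      (h₂.mono (List.subset_append_right _ _) (List.subset_append_right _ _)
      (List.subset_append_right _ _) (List.subset_append_right _ _))
  | iteTrue _ _ h =>
    exact h.mono (List.subset_append_left _ _) (List.subset_append_left _ _)
      (List.subset_append_left _ _) (List.subset_append_left _ _)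
  | iteFalse _ _ h =>
    exact h.mono (List.subset_append_right _ _) (List.subset_append_right _ _)
      (List.subset_append_right _ _) (List.subset_append_right _ _)
  | loopTrue _ _ _ h₁ h₂ =>
    exact Frame.trans ⟨h₁.nvar, h₁.narr, h₁.rvar, h₁.rarr⟩ h₂
  | loopFalse _ => exact Frame.refl _ _

/-- The nesting depth of the loops. -/
def Prog.depth : Prog → ℕ
  | .seq p q => max p.depth q.depth
  | .ite _ p q => max p.depth q.depth
  | .loop _ p => p.depth + 1
  | _ => 0

/-- A program all of whose loops are left after at most `Z` rounds takes at most
`coeff * Z ^ depth` steps. -/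
def Prog.coeff : Prog → ℕ
  | .skip => 1
  | .setN _ e => e.cost + 1
  | .putN _ i e => i.cost + e.cost + 1
  | .setR _ e => e.cost + 1
  | .putR _ i e => i.cost + e.cost + 1
  | .seq p q => p.coeff + q.coeff
  | .ite b p q => b.cost + 1 + p.coeff + q.coeff
  | .loop b p => 2 * (b.cost + 1) + p.coeff

/-- Started in `s`, the program `p` halts in a memory that satisfies `Q`, after a number of steps
that is as small as if no loop had more than `Z` rounds. -/
def Run (Z : ℕ) (p : Prog) (s : State) (Q : State → Prop) : Prop :=
  ∃ (t : ℕ) (s' : State), Exec p s t s' ∧ t ≤ p.coeff * Z ^ p.depth ∧ Q s'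

namespace Run

variable {Z : ℕ} {p q : Prog} {s : State} {Q R : State → Prop}

theorem mono_frame (h : Run Z p s R) (hQ : ∀ s', Frame p s s' → R s' → Q s') : Run Z p s Q := by
  obtain ⟨t, s', he, ht, hR⟩ := h
  exact ⟨t, s', he, ht, hQ s' he.frame hR⟩

theorem mono (h : Run Z p s R) (hQ : ∀ s', R s' → Q s') : Run Z p s Q :=
  h.mono_frame fun s' _ => hQ s'

theorem skip (h : Q s) : Run Z .skip s Q :=
  ⟨1, s, .skip s, by simp [Prog.coeff, Prog.depth], h⟩

theorem setN {x : ℕ} {e : NExp} (h : Q (s.setN x (e.eval s))) : Run Z (.setN x e) s Q :=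
  ⟨_, _, .setN x e s, by simp [Prog.coeff, Prog.depth], h⟩

theorem putN {a : ℕ} {i e : NExp} (h : Q (s.putN a (i.eval s) (e.eval s))) :
    Run Z (.putN a i e) s Q :=
  ⟨_, _, .putN a i e s, by simp [Prog.coeff, Prog.depth], h⟩

theorem setR {x : ℕ} {e : RExp} (h : Q (s.setR x (e.eval s))) : Run Z (.setR x e) s Q :=
  ⟨_, _, .setR x e s, by simp [Prog.coeff, Prog.depth], h⟩

theorem putR {a : ℕ} {i : NExp} {e : RExp} (h : Q (s.putR a (i.eval s) (e.eval s))) :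
    Run Z (.putR a i e) s Q :=
  ⟨_, _, .putR a i e s, by simp [Prog.coeff, Prog.depth], h⟩

theorem coeff_mul_pow_le (hZ : 1 ≤ Z) {a e e' : ℕ} (h : e ≤ e') : a * Z ^ e ≤ a * Z ^ e' :=
  Nat.mul_le_mul_left _ (Nat.pow_le_pow_right hZ h)

theorem seq (hZ : 1 ≤ Z) (h : Run Z p s fun s' => Run Z q s' Q) : Run Z (.seq p q) s Q := by
  obtain ⟨t₁, s₁, he₁, ht₁, t₂, s₂, he₂, ht₂, hQ⟩ := h
  refine ⟨_, _, .seq he₁ he₂, ?_, hQ⟩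
  have h₁ := coeff_mul_pow_le hZ (a := p.coeff) (le_max_left p.depth q.depth)
  have h₂ := coeff_mul_pow_le hZ (a := q.coeff) (le_max_right p.depth q.depth)
  simp only [Prog.coeff, Prog.depth, add_mul]
  omega

theorem ite (hZ : 1 ≤ Z) {b : BExp} (h₁ : b.Holds s → Run Z p s Q)
    (h₂ : ¬ b.Holds s → Run Z q s Q) : Run Z (.ite b p q) s Q := by
  have h₁' := coeff_mul_pow_le hZ (a := p.coeff) (le_max_left p.depth q.depth)
  have h₂' := coeff_mul_pow_le hZ (a := q.coeff) (le_max_right p.depth q.depth)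
  have h₃ : b.cost + 1 ≤ (b.cost + 1) * Z ^ max p.depth q.depth :=
    Nat.le_mul_of_pos_right _ (Nat.pow_pos hZ)
  by_cases hb : b.Holds s
  · obtain ⟨t, s', he, ht, hQ⟩ := h₁ hb
    refine ⟨_, _, .iteTrue hb he, ?_, hQ⟩
    simp only [Prog.coeff, Prog.depth, add_mul] at h₃ ⊢
    omega
  · obtain ⟨t, s', he, ht, hQ⟩ := h₂ hb
    refine ⟨_, _, .iteFalse hb he, ?_, hQ⟩
    simp only [Prog.coeff, Prog.depth, add_mul] at h₃ ⊢
    omega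

/-- Induction on the number `k` of rounds still to come; the failing test at the end accounts for `k
+ 1` tests. -/
theorem exists_exec_loop {b : BExp} {B : ℕ} (I : ℕ → State → Prop) (m : ℕ)
    (hstep : ∀ j < m, ∀ s, I j s → b.Holds s ∧ ∃ t s', Exec p s t s' ∧ t ≤ B ∧ I (j + 1) s')
    (hend : ∀ s, I m s → ¬ b.Holds s) (k j : ℕ) (hj : j + k = m) (s : State) (hs : I j s) :
    ∃ t s', Exec (.loop b p) s t s' ∧ t ≤ (k + 1) * (b.cost + 1) + k * B ∧ I m s' := by
  induction k generalizing j s with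
  | zero =>
    obtain rfl : j = m := by omega
    exact ⟨_, s, .loopFalse (hend s hs), by simp, hs⟩
  | succ k ih =>
    obtain ⟨hb, t, s', he, ht, hI⟩ := hstep j (by omega) s hs
    obtain ⟨t', s'', he', ht', hI'⟩ := ih (j + 1) (by omega) s' hI
    refine ⟨_, s'', .loopTrue hb he he', ?_, hI'⟩
    simp only [add_mul] at ht' ⊢
    omega

theorem loop (hZ : 1 ≤ Z) {b : BExp} (I : ℕ → State → Prop) (m : ℕ) (hm : m ≤ Z) (h₀ : I 0 s)
    (hstep : ∀ j < m, ∀ s, I j s → b.Holds s ∧ Run Z p s (I (j + 1)))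
    (hend : ∀ s, I m s → ¬ b.Holds s) : Run Z (.loop b p) s (I m) := by
  obtain ⟨t, s', he, ht, hI⟩ := exists_exec_loop I m hstep hend m 0 (by omega) s h₀
  refine ⟨t, s', he, ht.trans ?_, hI⟩
  have h₁ : m * (p.coeff * Z ^ p.depth) ≤ p.coeff * (Z ^ p.depth * Z) := by
    rw [mul_comm, mul_assoc]
    exact Nat.mul_le_mul_left _ (Nat.mul_le_mul_left _ hm)
  -- Since `m ≤ Z` and `1 ≤ Z`, the `m + 1` tests are at most `2 * Z`, whence the factor `2` in
  -- `Prog.coeff`.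
  have h₂ : (m + 1) * (b.cost + 1) ≤ 2 * (b.cost + 1) * (Z ^ p.depth * Z) := by
    have : 1 * Z ≤ Z ^ p.depth * Z := Nat.mul_le_mul_right _ (Nat.pow_pos hZ)
    calc (m + 1) * (b.cost + 1) ≤ (2 * Z) * (b.cost + 1) := Nat.mul_le_mul_right _ (by omega)
      _ = 2 * (b.cost + 1) * (1 * Z) := by ring
      _ ≤ _ := Nat.mul_le_mul_left _ this
  simp only [Prog.coeff, Prog.depth, pow_succ]
  rw [add_mul (2 * (b.cost + 1))]
  exact add_le_add h₂ h₁

end Run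

/-- `for (x = 0; x < b; x = x + e) p`. -/
def Prog.count (x : ℕ) (b e : NExp) (p : Prog) : Prog :=
  .seq (.setN x (.lit 0))
    (.loop (.not (.nle b (.var x))) (.seq p (.setN x (.add (.var x) e))))

/-- The rule for counting loops.  The loop has `m` rounds, and its counter grows by `σ` in each. -/
theorem Run.count {Z : ℕ} (hZ : 1 ≤ Z) {x : ℕ} {b e : NExp} {p : Prog} {s : State}
    {Q : State → Prop} (I : ℕ → State → Prop) (m σ : ℕ) (hσ : 1 ≤ σ) (hm : m ≤ Z)
    (hb : ∀ s', Frame (.count x b e p) s s' → b.eval s' = m * σ)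
    (he : ∀ s', Frame (.count x b e p) s s' → e.eval s' = σ)
    (hx : x ∉ p.nvars) (hI : ∀ j s v, I j s → I j (s.setN x v)) (h₀ : I 0 s)
    (hstep : ∀ j < m, ∀ s', Frame (.count x b e p) s s' → s'.nvar x = j * σ → I j s' →
      Run Z p s' (I (j + 1)))
    (hQ : ∀ s', Frame (.count x b e p) s s' → I m s' → Q s') :
    Run Z (.count x b e p) s Q := by
  have hF₀ : ∀ v, Frame (.count x b e p) s (s.setN x v) := fun v =>
    (Exec.setN x (.lit v) s).frame.mono (List.subset_append_left _ _) (by simp [Prog.narrs])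
      (by simp [Prog.rvars]) (by simp [Prog.rarrs])
  have hFp : ∀ {s₁ s₂}, Frame p s₁ s₂ → Frame (.count x b e p) s₁ s₂ := fun h => by
    refine h.mono ?_ ?_ ?_ ?_ <;> intro y hy <;>
      simp [Prog.count, Prog.nvars, Prog.narrs, Prog.rvars, Prog.rarrs, hy]
  -- The invariant is strengthened by the value of the counter and by the frame relative to the
  -- initial memory, which keeps the bound and the increment constant.
  refine Run.seq hZ (Run.setN ?_)
  refine Run.mono (Run.loop hZ
    (fun j s' => Frame (.count x b e p) s s' ∧ s'.nvar x = j * σ ∧ I j s') m hm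
    ⟨hF₀ _, by simp [State.setN, NExp.eval], hI _ _ _ h₀⟩ ?_ ?_)
    (fun s' h => hQ s' h.1 h.2.2)
  · rintro j hj s' ⟨hF, hs', hIj⟩
    refine ⟨?_, Run.seq hZ (Run.mono_frame (hstep j hj s' hF hs' hIj) ?_)⟩
    · simp only [BExp.Holds, NExp.eval, hb s' hF, hs', not_le]
      exact Nat.mul_lt_mul_of_pos_right hj hσ
    · intro s'' hF' hI'
      have hF'' := hF.trans (hFp hF')
      refine Run.setN ⟨hF''.trans ?_, ?_, hI _ _ _ hI'⟩
      · exact (Exec.setN x (.lit _) s'').frame.mono (List.subset_append_left _ _)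
          (by simp [Prog.narrs]) (by simp [Prog.rvars]) (by simp [Prog.rarrs])
      · simp [State.setN, NExp.eval, he s'' hF'', hF'.nvar x hx, hs', add_mul]
  · rintro s' ⟨hF, hs', -⟩
    simp [BExp.Holds, NExp.eval, hb s' hF, hs']

end RAM

/-! ### Rooted trees and separation in tree decompositions -/

section RootedTree

variable {V ι : Type*} {G : SimpleGraph V} {T : SimpleGraph ι} {r : ι} {X : ι → Set V}

/-- Shortest walks from the root to the two parents extend to shortest walks to `s`; these are
paths, so they coincide in a tree, and so do their last edges. -/
theorem IsChild.parent_unique (hT : T.IsTree) {s t t' : ι} (h : IsChild T r t s)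
    (h' : IsChild T r t' s) : t = t' := by
  obtain ⟨p, hp⟩ := hT.connected.exists_walk_length_eq_dist r t
  obtain ⟨p', hp'⟩ := hT.connected.exists_walk_length_eq_dist r t'
  have h₁ : (p.concat h.1).IsPath :=
    SimpleGraph.Walk.isPath_of_length_eq_dist _ (by simp [hp, h.2])
  have h₂ : (p'.concat h'.1).IsPath :=
    SimpleGraph.Walk.isPath_of_length_eq_dist _ (by simp [hp', h'.2])
  have := (hT.existsUnique_path r s).unique h₁ h₂
  exact (SimpleGraph.Walk.concat_inj this).1

theorem isChild_or_isChild (hT : T.IsTree) {a b : ι} (h : T.Adj a b) :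
    IsChild T r a b ∨ IsChild T r b a := by
  rcases hT.dist_eq_dist_add_one_of_adj r h with h' | h'
  · exact .inr ⟨h.symm, h'⟩
  · exact .inl ⟨h, h'⟩

/-- In the tree `T` rooted at `r`, the node `u` lies below `t`, or is `t`. -/
def IsDescendant (T : SimpleGraph ι) (r t u : ι) : Prop :=
  Relation.ReflTransGen (IsChild T r) t u

theorem IsDescendant.dist_le {t u : ι} (h : IsDescendant T r t u) : T.dist r t ≤ T.dist r u := by
  induction h with
  | refl => exact le_rfl
  | tail _ h ih => exact ih.trans (by rw [h.2]; omega)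

theorem IsDescendant.eq_of_dist_le {t u : ι} (h : IsDescendant T r t u)
    (h' : T.dist r u ≤ T.dist r t) : t = u := by
  rcases Relation.ReflTransGen.cases_tail h with h | ⟨c, hc, h⟩
  · exact h.symm
  · have := IsDescendant.dist_le hc
    have := h.2
    omega

theorem isDescendant_root (hT : T.IsTree) (u : ι) : IsDescendant T r r u := by
  obtain ⟨p⟩ := hT.connected r u
  suffices ∀ {a b : ι} (p : T.Walk a b), IsDescendant T r r a → IsDescendant T r r b from
    this p .refl
  intro a b p
  induction p with
  | nil => exact id
  | @cons a b _ h p ih =>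
    refine fun ha => ih ?_
    rcases isChild_or_isChild hT (r := r) h with h | h
    · exact .tail ha h
    · rcases Relation.ReflTransGen.cases_tail ha with rfl | ⟨c, hc, h'⟩
      · have := h.2
        simp at this
      · rwa [IsChild.parent_unique hT h h']

/-- The edge to the parent is the only one that leaves the subtree below `s`. -/
theorem eq_and_eq_of_adj_of_not_isDescendant (hT : T.IsTree) {s t a b : ι} (hst : IsChild T r t s)
    (hab : T.Adj a b) (ha : IsDescendant T r s a) (hb : ¬ IsDescendant T r s b) :
    a = s ∧ b = t := by
  rcases isChild_or_isChild hT (r := r) hab with h | h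
  · exact absurd (.tail ha h) hb
  · rcases Relation.ReflTransGen.cases_tail ha with rfl | ⟨c, hc, h'⟩
    · exact ⟨rfl, IsChild.parent_unique hT h hst⟩
    · exact absurd (IsChild.parent_unique hT h' h ▸ hc) hb

/-- Parents are unique, so the ancestors of `u` form a chain, in which two nodes of equal depth are
equal. -/
theorem IsDescendant.eq_of_siblings (hT : T.IsTree) {t s s' u : ι} (hs : IsChild T r t s)
    (hs' : IsChild T r t s') (h : IsDescendant T r s u) (h' : IsDescendant T r s' u) : s = s' := by
  have hU : Relator.RightUnique (Function.swap (IsChild T r)) :=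
    fun a b c hb hc => IsChild.parent_unique hT hb hc
  have hd : T.dist r s = T.dist r s' := hs.2.trans hs'.2.symm
  rcases Relation.ReflTransGen.total_of_right_unique hU
    (Relation.reflTransGen_swap.2 h) (Relation.reflTransGen_swap.2 h') with h | h
  · exact (IsDescendant.eq_of_dist_le (Relation.reflTransGen_swap.1 h) hd.le).symm
  · exact IsDescendant.eq_of_dist_le (Relation.reflTransGen_swap.1 h) hd.ge

/-- The nodes whose bags contain `v` are connected, so a walk among them from `a` to `b` has to
cross the edge between `s` and `t`. -/
theorem IsTreeDecomposition.mem_of_separated (h : IsTreeDecomposition G T X) {s t a b : ι}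
    (hst : IsChild T r t s) {v : V} (ha : v ∈ X a) (hb : v ∈ X b) (hsa : IsDescendant T r s a)
    (hsb : ¬ IsDescendant T r s b) : v ∈ X t ∧ v ∈ X s := by
  obtain ⟨p⟩ := (h.connected v).preconnected ⟨a, ha⟩ ⟨b, hb⟩
  obtain ⟨d, -, h₁, h₂⟩ := p.exists_boundary_dart {x | IsDescendant T r s x.1} hsa hsb
  obtain ⟨h₃, h₄⟩ := eq_and_eq_of_adj_of_not_isDescendant h.isTree hst d.adj h₁ h₂
  exact ⟨h₄ ▸ d.snd.2, h₃ ▸ d.fst.2⟩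

/-- The vertices in the bags of the nodes below `t`. -/
def verticesBelow (T : SimpleGraph ι) (r : ι) (X : ι → Set V) (t : ι) : Set V :=
  {v | ∃ u, IsDescendant T r t u ∧ v ∈ X u}

theorem subset_verticesBelow (t : ι) : X t ⊆ verticesBelow T r X t := fun _ h => ⟨t, .refl, h⟩

theorem verticesBelow_root (h : IsTreeDecomposition G T X) :
    verticesBelow T r X r = Set.univ :=
  Set.eq_univ_of_forall fun v =>
    (h.vertex_mem v).imp fun u hu => ⟨isDescendant_root h.isTree u, hu⟩

/-- The vertices in the bag of `t` and those below the children of `t` that belong to `A`. -/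
def verticesBelowPart (T : SimpleGraph ι) (r : ι) (X : ι → Set V) (t : ι) (A : Set ι) : Set V :=
  X t ∪ ⋃ s ∈ {s | s ∈ A ∧ IsChild T r t s}, verticesBelow T r X s

theorem mem_verticesBelowPart {t : ι} {A : Set ι} {v : V} :
    v ∈ verticesBelowPart T r X t A ↔
      v ∈ X t ∨ ∃ s, (s ∈ A ∧ IsChild T r t s) ∧ v ∈ verticesBelow T r X s := by
  simp [verticesBelowPart]

theorem verticesBelowPart_univ (t : ι) :
    verticesBelowPart T r X t Set.univ = verticesBelow T r X t := by
  ext v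
  rw [mem_verticesBelowPart]
  constructor
  · rintro (h | ⟨s, ⟨-, hs⟩, u, hu, hv⟩)
    · exact ⟨t, .refl, h⟩
    · exact ⟨u, .head hs hu, hv⟩
  · rintro ⟨u, hu, hv⟩
    rcases Relation.ReflTransGen.cases_head hu with rfl | ⟨c, hc, h⟩
    · exact .inl hv
    · exact .inr ⟨c, ⟨trivial, hc⟩, u, h, hv⟩

theorem verticesBelowPart_insert {s t : ι} (hst : IsChild T r t s) (A : Set ι) :
    verticesBelowPart T r X t (insert s A) =
      verticesBelowPart T r X t A ∪ verticesBelow T r X s := by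
  ext v
  simp only [Set.mem_union, mem_verticesBelowPart, Set.mem_insert_iff]
  constructor
  · rintro (h | ⟨s', ⟨rfl | h, h'⟩, hv⟩)
    · exact .inl (.inl h)
    · exact .inr hv
    · exact .inl (.inr ⟨s', ⟨h, h'⟩, hv⟩)
  · rintro ((h | ⟨s', ⟨h, h'⟩, hv⟩) | h)
    · exact .inl h
    · exact .inr ⟨s', ⟨.inr h, h'⟩, hv⟩
    · exact .inr ⟨s, ⟨.inl rfl, hst⟩, h⟩

theorem verticesBelowPart_insert_of_not_isChild {s t : ι} (hst : ¬ IsChild T r t s) (A : Set ι) :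
    verticesBelowPart T r X t (insert s A) = verticesBelowPart T r X t A := by
  ext v
  simp only [mem_verticesBelowPart, Set.mem_insert_iff]
  refine or_congr_right (exists_congr fun s' => and_congr_left fun _ => ?_)
  exact ⟨fun ⟨h, h'⟩ => ⟨h.resolve_left fun e => hst (e ▸ h'), h'⟩, fun ⟨h, h'⟩ => ⟨.inr h, h'⟩⟩

theorem verticesBelowPart_empty (t : ι) : verticesBelowPart T r X t ∅ = X t := by
  simp [verticesBelowPart]

theorem not_isDescendant_of_isChild {s t : ι} (hst : IsChild T r t s) :
    ¬ IsDescendant T r s t := fun h => by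
  have := IsDescendant.dist_le h
  have := hst.2
  omega

/-- When the child `s` is glued on, its part meets what has been assembled so far only in the
separator, the common part of the two bags. -/
theorem IsTreeDecomposition.mem_of_mem_verticesBelowPart (h : IsTreeDecomposition G T X)
    {s t : ι} (hst : IsChild T r t s) {A : Set ι} (hA : s ∉ A) {v : V}
    (hv : v ∈ verticesBelowPart T r X t A) (hv' : v ∈ verticesBelow T r X s) :
    v ∈ X t ∧ v ∈ X s := by
  obtain ⟨a, hsa, ha⟩ := hv'
  rcases mem_verticesBelowPart.1 hv with hv | ⟨s', ⟨hs'A, hts'⟩, b, hb, hvb⟩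
  · exact h.mem_of_separated hst ha hv hsa (not_isDescendant_of_isChild hst)
  · refine h.mem_of_separated hst ha hvb hsa fun hsb => hA ?_
    rwa [IsDescendant.eq_of_siblings h.isTree hst hts' hsb hb]

/-- No edge jumps over the separator: a bag containing the edge lies either below `s` or outside
that subtree. -/
theorem IsTreeDecomposition.mem_or_mem_of_adj (h : IsTreeDecomposition G T X)
    {s t : ι} (hst : IsChild T r t s) {u v : V} (hv : v ∈ verticesBelow T r X s)
    (huv : G.Adj u v) : u ∈ verticesBelow T r X s ∨ v ∈ X t := by
  obtain ⟨a, hsa, ha⟩ := hv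
  obtain ⟨b, hub, hvb⟩ := h.edge_mem u v huv
  by_cases hb : IsDescendant T r s b
  · exact .inl ⟨b, hb, hub⟩
  · exact .inr (h.mem_of_separated hst ha hvb hsa hb).1

theorem SimpleGraph.IsTree.dist_lt_card [Fintype ι] (hT : T.IsTree) (t : ι) :
    T.dist r t < Fintype.card ι := by
  obtain ⟨p, hp, hp'⟩ := (hT.connected r t).exists_path_of_dist
  exact hp' ▸ hp.length_lt

end RootedTree

/-! ### Partial colorings and optimal extensions -/

section Coloring

variable {V : Type*}

/-- `F` is a proper coloring of some vertices of `G` with the colors `1, …, d`; the vertices of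
color `0` are those without a color. -/
def IsPartialColoring (G : SimpleGraph V) (d : ℕ) (F : V → ℕ) : Prop :=
  (∀ v, F v ≤ d) ∧ ∀ u v, G.Adj u v → F u ≠ 0 → F u ≠ F v

open Classical in
/-- The coloring `F` restricted to the set `U`. -/
noncomputable def restrictTo (U : Set V) (F : V → ℕ) : V → ℕ := fun v => if v ∈ U then F v else 0

/-- Color the vertices that `F` leaves out with `F'`. -/
def overlay (F F' : V → ℕ) : V → ℕ := fun v => if F v = 0 then F' v else F v

/-- The weight of the colored vertices. -/
noncomputable def coloredWeight [Fintype V] (w : V → ℝ) (F : V → ℕ) : ℝ := ∑ v, if F v = 0 then 0 else w v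

/-- Among the partial colorings of `G` that color vertices of `U` only and agree with `f` on `X`,
`F` is one of maximum weight. -/
structure IsOptimalExtension [Fintype V] (G : SimpleGraph V) (d : ℕ) (w : V → ℝ) (U X : Set V)
    (f F : V → ℕ) : Prop where
  proper : IsPartialColoring G d F
  supp : ∀ v, F v ≠ 0 → v ∈ U
  agree : ∀ v ∈ X, F v = f v
  le : ∀ F', IsPartialColoring G d F' → (∀ v, F' v ≠ 0 → v ∈ U) → (∀ v ∈ X, F' v = f v) →
    coloredWeight w F' ≤ coloredWeight w F

variable {G : SimpleGraph V} {d : ℕ} {w : V → ℝ}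

theorem IsPartialColoring.restrictTo {F : V → ℕ} (h : IsPartialColoring G d F) (U : Set V) :
    IsPartialColoring G d (restrictTo U F) := by
  classical
  refine ⟨fun v => ?_, fun u v huv hu => ?_⟩
  · have := h.1 v
    unfold _root_.restrictTo
    split_ifs <;> omega
  · have := h.2 u v huv
    unfold _root_.restrictTo at hu ⊢
    split_ifs at hu ⊢ <;> simp_all

theorem mem_of_restrictTo_ne_zero {U : Set V} {F : V → ℕ} {v : V} (h : restrictTo U F v ≠ 0) :
    v ∈ U := by
  classical
  by_contra h'
  exact h (if_neg h')

theorem restrictTo_of_mem {U : Set V} {F : V → ℕ} {v : V} (h : v ∈ U) :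
    restrictTo U F v = F v := if_pos h

theorem restrictTo_of_notMem {U : Set V} {F : V → ℕ} {v : V} (h : v ∉ U) :
    restrictTo U F v = 0 := if_neg h

theorem isOptimalExtension_self [Fintype V] {X : Set V} {f : V → ℕ}
    (hf : IsPartialColoring G d f) (hX : ∀ v, f v ≠ 0 → v ∈ X) :
    IsOptimalExtension G d w X X f f := by
  refine ⟨hf, hX, fun _ _ => rfl, fun F' _ h h' => le_of_eq ?_⟩
  congr 1
  funext v
  by_cases hv : v ∈ X
  · exact h' v hv
  · rw [not_not.1 (mt (h v) hv), not_not.1 (mt (hX v) hv)]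

/-- Inclusion and exclusion for weights. -/
theorem coloredWeight_add_restrictTo_inter [Fintype V] {U W : Set V} {F : V → ℕ}
    (h : ∀ v, F v ≠ 0 → v ∈ U ∪ W) :
    coloredWeight w F + coloredWeight w (restrictTo (U ∩ W) F) =
      coloredWeight w (restrictTo U F) + coloredWeight w (restrictTo W F) := by
  classical
  simp only [coloredWeight, ← Finset.sum_add_distrib]
  refine Finset.sum_congr rfl fun v _ => ?_
  have := h v
  by_cases hU : v ∈ U <;> by_cases hW : v ∈ W <;> by_cases hF : F v = 0 <;>
    simp_all [restrictTo]

/-- Gluing optimal extensions along a separator. -/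
theorem IsOptimalExtension.overlay [Fintype V] {U W X Y : Set V} {f g F₁ F₂ : V → ℕ}
    (hXU : X ⊆ U) (hYW : Y ⊆ W) (hUW : U ∩ W ⊆ X ∩ Y)
    (hadj : ∀ u ∈ U, ∀ v ∈ W, G.Adj u v → u ∈ W ∨ v ∈ U)
    (h₁ : IsOptimalExtension G d w U X f F₁) (h₂ : IsOptimalExtension G d w W Y g F₂)
    (hfg : ∀ v ∈ X, v ∈ Y → g v = f v)
    (hbest : ∀ g', IsPartialColoring G d g' → (∀ v, g' v ≠ 0 → v ∈ Y) →
      (∀ v ∈ X, v ∈ Y → g' v = f v) →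
      ∃ F', IsOptimalExtension G d w W Y g' F' ∧ coloredWeight w F' ≤ coloredWeight w F₂) :
    IsOptimalExtension G d w (U ∪ W) X f (overlay F₁ F₂) := by
  have hF₁ : ∀ v ∉ U, F₁ v = 0 := fun v hv => not_not.1 (mt (h₁.supp v) hv)
  have hF₂ : ∀ v ∉ W, F₂ v = 0 := fun v hv => not_not.1 (mt (h₂.supp v) hv)
  have hcommon : ∀ v ∈ U, v ∈ W → F₁ v = F₂ v := fun v hU hW => by
    obtain ⟨hX, hY⟩ := hUW ⟨hU, hW⟩
    rw [h₁.agree v hX, h₂.agree v hY, hfg v hX hY]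
  have hU : ∀ v ∈ U, _root_.overlay F₁ F₂ v = F₁ v := fun v hv => by
    unfold _root_.overlay
    split_ifs with h
    · by_cases hW : v ∈ W
      · exact (hcommon v hv hW).symm
      · rw [hF₂ v hW, h]
    · rfl
  have hW : ∀ v ∈ W, _root_.overlay F₁ F₂ v = F₂ v := fun v hv => by
    by_cases h : v ∈ U
    · rw [hU v h, hcommon v h hv]
    · simp [_root_.overlay, hF₁ v h]
  have hsupp : ∀ v, _root_.overlay F₁ F₂ v ≠ 0 → v ∈ U ∪ W := fun v hv => by
    by_contra h
    rw [Set.mem_union, not_or] at h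
    simp [_root_.overlay, hF₁ v h.1, hF₂ v h.2] at hv
  refine ⟨⟨fun v => ?_, fun u v huv hu heq => ?_⟩, hsupp, fun v hv => ?_, fun F' hF' hs ha => ?_⟩
  · unfold _root_.overlay
    split_ifs
    · exact h₂.proper.1 v
    · exact h₁.proper.1 v
  · have hv := hsupp v (heq ▸ hu)
    have hbothU : u ∈ U → v ∈ U → False := fun hu' hv' => by
      rw [hU u hu', hU v hv'] at heq
      exact h₁.proper.2 u v huv (hU u hu' ▸ hu) heq
    have hbothW : u ∈ W → v ∈ W → False := fun hu' hv' => by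
      rw [hW u hu', hW v hv'] at heq
      exact h₂.proper.2 u v huv (hW u hu' ▸ hu) heq
    rcases hsupp u hu with hu' | hu' <;> rcases hv with hv' | hv'
    · exact hbothU hu' hv'
    · exact (hadj u hu' v hv' huv).elim (hbothW · hv') (hbothU hu')
    · exact (hadj v hv' u hu' huv.symm).elim (hbothW hu') (hbothU · hv')
    · exact hbothW hu' hv'
  · rw [hU v (hXU hv), h₁.agree v hv]
  -- A competitor `F'` is split into its parts on `U` and on `W`. The part on `W` is beaten by the
  -- best extension of its trace on `Y`, hence by `F₂`. The parts on `U ∩ W` cancel, because `f`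
  -- prescribes the colors there.
  · obtain ⟨F'', hF'', hle⟩ := hbest (restrictTo Y F') (hF'.restrictTo Y)
      (fun v => mem_of_restrictTo_ne_zero) fun v hX hY => by rw [restrictTo_of_mem hY, ha v hX]
    have hle₁ := h₁.le (restrictTo U F') (hF'.restrictTo U) (fun v => mem_of_restrictTo_ne_zero)
      fun v hX => by rw [restrictTo_of_mem (hXU hX), ha v hX]
    have hle₂ := hF''.le (restrictTo W F') (hF'.restrictTo W)
      (fun v => mem_of_restrictTo_ne_zero)
      fun v hY => by rw [restrictTo_of_mem (hYW hY), restrictTo_of_mem hY]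
    have e := coloredWeight_add_restrictTo_inter (w := w) hs
    have e' := coloredWeight_add_restrictTo_inter (w := w) hsupp
    have e₁ : restrictTo U (_root_.overlay F₁ F₂) = F₁ := by
      funext v
      by_cases hv : v ∈ U
      · rw [restrictTo_of_mem hv, hU v hv]
      · rw [restrictTo_of_notMem hv, hF₁ v hv]
    have e₂ : restrictTo W (_root_.overlay F₁ F₂) = F₂ := by
      funext v
      by_cases hv : v ∈ W
      · rw [restrictTo_of_mem hv, hW v hv]
      · rw [restrictTo_of_notMem hv, hF₂ v hv]
    have e₃ : restrictTo (U ∩ W) (_root_.overlay F₁ F₂) = restrictTo (U ∩ W) F' := by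
      funext v
      by_cases hv : v ∈ U ∩ W
      · have hX := (hUW hv).1
        rw [restrictTo_of_mem hv, restrictTo_of_mem hv, hU v hv.1, h₁.agree v hX, ha v hX]
      · rw [restrictTo_of_notMem hv, restrictTo_of_notMem hv]
    rw [e₁, e₂, e₃] at e'
    linarith

/-- The support of a heaviest partial coloring solves Weighted `d`-colorable Subgraph. -/
theorem isMaxWeightColorable_of_isOptimalExtension [Fintype V] [DecidableEq V] {f F : V → ℕ}
    (h : IsOptimalExtension G d w Set.univ ∅ f F) :
    IsMaxWeightColorable d G w (Finset.univ.filter fun v => F v ≠ 0) := by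
  classical
  have hsum : ∀ F' : V → ℕ, coloredWeight w F' = ∑ v with F' v ≠ 0, w v := fun F' => by
    rw [coloredWeight, Finset.sum_filter]
    simp [ite_not]
  refine ⟨⟨SimpleGraph.Coloring.mk (fun v => ⟨F v.1 - 1, ?_⟩) ?_⟩, fun S hS => ?_⟩
  · have h₁ := v.2
    have h₂ := h.proper.1 v
    simp only [Finset.coe_filter, Finset.mem_univ, true_and, Set.mem_ofPred_eq] at h₁
    omega
  · intro u v huv heq
    have h₁ := u.2
    have h₂ := v.2
    simp only [Finset.coe_filter, Finset.mem_univ, true_and, Set.mem_ofPred_eq] at h₁ h₂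
    simp only [Fin.mk.injEq] at heq
    exact h.proper.2 u v huv h₁ (by omega)
  · obtain ⟨C⟩ := hS
    let F' : V → ℕ := fun v => if hv : v ∈ S then (C ⟨v, hv⟩ : ℕ) + 1 else 0
    have hF' : ∀ v, F' v ≠ 0 ↔ v ∈ S := fun v => by simp [F']
    have := h.le F' ⟨fun v => ?_, fun u v huv hu heq => ?_⟩ (fun _ _ => trivial) (by simp)
    · rw [hsum, hsum] at this
      simpa only [hF', Finset.filter_mem_eq_inter, Finset.univ_inter] using this
    · simp only [F']
      split_ifs with hv
      · exact (C ⟨v, hv⟩).2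
      · exact Nat.zero_le _
    · have hv := (hF' v).1 (heq ▸ hu)
      have hu := (hF' u).1 hu
      simp only [F', dif_pos hu, dif_pos hv, add_left_inj] at heq
      exact C.valid (show (G.induce (S : Set V)).Adj ⟨u, hu⟩ ⟨v, hv⟩ from huv) (Fin.ext heq)

/-- With as many colors as vertices every induced subgraph is colorable, so further colors change
nothing. -/
theorem IsMaxWeightColorable.of_min_card [Fintype V] {S : Finset V}
    (h : IsMaxWeightColorable (min d (Fintype.card V)) G w S) : IsMaxWeightColorable d G w S := by
  refine ⟨h.1.mono (min_le_left _ _), fun S' hS' => h.2 S' ?_⟩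
  rcases min_cases d (Fintype.card V) with ⟨h, -⟩ | ⟨h, -⟩
  · rwa [h]
  · rw [h]
    refine (SimpleGraph.colorable_of_fintype (G.induce (S' : Set V))).mono ?_
    simpa using Finset.card_le_univ S'

end Coloring

/-! ### Counting the partial colorings of an almost complete graph -/

section Counting

/-- A graph with at most `k` edges has at most `(n + 1) * 2 ^ (√(2k) + 1)` cliques. -/
theorem SimpleGraph.card_cliques_le {W : Type*} [Fintype W] (H : SimpleGraph W) {k : ℕ}
    (hk : H.edgeSet.ncard ≤ k) (S : Finset (Finset W)) (hS : ∀ I ∈ S, H.IsClique (I : Set W)) :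
    S.card ≤ (Fintype.card W + 1) * 2 ^ (Nat.sqrt (2 * k) + 1) := by
  classical
  -- The least `D` with `2 * k < D * D`; as the degrees sum to at most `2 * k`, fewer than `D`
  -- vertices have degree at least `D`.
  set D := Nat.sqrt (2 * k) + 1 with hD
  set high : Finset W := Finset.univ.filter fun v => D ≤ H.degree v with hhigh
  have hsum : ∑ v, H.degree v ≤ 2 * k := by
    rw [H.sum_degrees_eq_twice_card_edges, ← SimpleGraph.coe_edgeFinset, Set.ncard_coe_finset] at *
    omega
  have hcard : high.card ≤ D := by
    have h₁ : high.card * D ≤ ∑ v ∈ high, H.degree v := by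
      rw [← smul_eq_mul]
      exact Finset.card_nsmul_le_sum _ _ _ fun v hv => (Finset.mem_filter.1 hv).2
    have h₂ : ∑ v ∈ high, H.degree v ≤ ∑ v, H.degree v :=
      Finset.sum_le_sum_of_subset (Finset.subset_univ _)
    have h₃ : 2 * k < D * D := Nat.lt_succ_sqrt (2 * k)
    exact (Nat.lt_of_mul_lt_mul_right (h₁.trans (h₂.trans hsum) |>.trans_lt h₃)).le
  -- A clique with a vertex `v` of low degree lies in the closed neighborhood of `v`, which has at
  -- most `D` elements.
  have hsub : S ⊆ high.powerset ∪ (Finset.univ.filter fun v => H.degree v < D).biUnion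
      fun v => (insert v (H.neighborFinset v)).powerset := fun I hI => by
    rw [Finset.mem_union, Finset.mem_powerset, Finset.mem_biUnion]
    by_cases h : I ⊆ high
    · exact .inl h
    · obtain ⟨v, hv, hv'⟩ := Finset.not_subset.1 h
      refine .inr ⟨v, by simpa [hhigh] using hv', Finset.mem_powerset.2 fun u hu => ?_⟩
      rw [Finset.mem_insert, SimpleGraph.mem_neighborFinset]
      exact or_iff_not_imp_left.2 fun hne => hS I hI hv hu (Ne.symm hne)
  calc S.card ≤ 2 ^ D + Fintype.card W * 2 ^ D := by
        refine (Finset.card_le_card hsub).trans ((Finset.card_union_le _ _).trans ?_)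
        refine Nat.add_le_add ?_ ?_
        · rw [Finset.card_powerset]
          exact Nat.pow_le_pow_right two_pos hcard
        · refine (Finset.card_biUnion_le_card_mul _ _ (2 ^ D) fun v hv => ?_).trans
            (Nat.mul_le_mul_right _ (Finset.card_le_univ _))
          rw [Finset.card_powerset]
          refine Nat.pow_le_pow_right two_pos ((Finset.card_insert_le _ _).trans ?_)
          exact (Finset.mem_filter.1 hv).2
    _ = _ := by ring

/-- A coloring is encoded by its `d` color classes, each a clique of the complement `H` of the graph
on `X`. The encoding is injective, because color `0` marks exactly the vertices in no class. -/
theorem card_partialColorings_le {V : Type*} [Fintype V] {G : SimpleGraph V} {d k : ℕ}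
    {X : Set V} (hk : cliqueCompletionSize (G.induce X) ≤ k) (S : Finset (V → ℕ))
    (hS : ∀ f ∈ S, IsPartialColoring G d f ∧ ∀ v, f v ≠ 0 → v ∈ X) :
    S.card ≤ ((Fintype.card V + 1) * 2 ^ (Nat.sqrt (2 * k) + 1)) ^ d := by
  classical
  let H : SimpleGraph X := ⊤ \ G.induce X
  have hH : H.edgeSet.ncard ≤ k := by
    rw [SimpleGraph.edgeSet_sdiff]
    exact hk
  let 𝓘 : Finset (Finset X) := Finset.univ.filter fun I => H.IsClique (I : Set X)
  have h𝓘 : 𝓘.card ≤ (Fintype.card V + 1) * 2 ^ (Nat.sqrt (2 * k) + 1) :=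
    (H.card_cliques_le hH 𝓘 fun I hI => (Finset.mem_filter.1 hI).2).trans
      (Nat.mul_le_mul_right _ (Nat.succ_le_succ (Fintype.card_subtype_le _)))
  let φ : (V → ℕ) → Fin d → Finset X := fun f j => Finset.univ.filter fun x => f x = (j : ℕ) + 1
  have hmaps : ∀ f ∈ S, φ f ∈ Fintype.piFinset fun _ : Fin d => 𝓘 := fun f hf => by
    refine Fintype.mem_piFinset.2 fun j => Finset.mem_filter.2 ⟨Finset.mem_univ _, ?_⟩
    intro x hx y hy hxy
    have hx : f x = (j : ℕ) + 1 := by simpa [φ] using hx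
    have hy : f y = (j : ℕ) + 1 := by simpa [φ] using hy
    refine ⟨hxy, fun h => (hS f hf).1.2 x y h (by omega) (by omega)⟩
  have hinj : Set.InjOn φ S := fun f hf g hg h => by
    have key : ∀ {f g : V → ℕ}, f ∈ S → φ f = φ g → ∀ v, f v ≠ 0 → g v = f v := by
      intro f g hf h v hv
      obtain ⟨⟨hd, -⟩, hX⟩ := hS f hf
      have := hd v
      have h' : (⟨v, hX v hv⟩ : X) ∈ φ f ⟨f v - 1, by omega⟩ := by
        simp only [φ, Finset.mem_filter, Finset.mem_univ, true_and]
        omega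
      rw [h] at h'
      simp only [φ, Finset.mem_filter, Finset.mem_univ, true_and] at h'
      omega
    funext v
    by_cases hv : f v = 0
    · by_contra hne
      exact hne (key hg h.symm v fun h0 => hne (hv.trans h0.symm))
    · exact (key hf h v hv).symm
  calc S.card ≤ (Fintype.piFinset fun _ : Fin d => 𝓘).card :=
        Finset.card_le_card_of_injOn φ hmaps hinj
    _ = 𝓘.card ^ d := by simp
    _ ≤ _ := Nat.pow_le_pow_left h𝓘 d

end Counting

/-! ### The list of the partial colorings of the bags -/

section Items

variable {n N : ℕ} (G : SimpleGraph (Fin n)) (X : Fin N → Set (Fin n)) (d : ℕ)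

/-- The vertex `i` belongs to the bag of the item `x`, and color `c` is possible for it. -/
def IsAllowed (x : Fin N × (Fin n → ℕ)) (i : Fin n) (c : ℕ) : Prop :=
  i ∈ X x.1 ∧ ∀ u, ¬ (x.2 u = c ∧ G.Adj i u)

open Classical in
/-- The items that arise from `x` by giving `i` one of the colors `1, …, m`. -/
noncomputable def extensions (i : Fin n) (m : ℕ) (x : Fin N × (Fin n → ℕ)) :
    List (Fin N × (Fin n → ℕ)) :=
  ((List.range m).filter fun j => IsAllowed G X x i (j + 1)).map
    fun j => (x.1, Function.update x.2 i (j + 1))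

/-- The pairs of a node and a partial coloring of those vertices of its bag that are less
than `m`. -/
noncomputable def items : ℕ → List (Fin N × (Fin n → ℕ))
  | 0 => (List.finRange N).map fun t => (t, fun _ => 0)
  | m + 1 => if h : m < n then items m ++ (items m).flatMap (extensions G X ⟨m, h⟩ d) else items m

variable {G X d}

open Classical in
theorem extensions_succ (i : Fin n) (m : ℕ) (x : Fin N × (Fin n → ℕ)) :
    extensions G X i (m + 1) x = extensions G X i m x ++
      if IsAllowed G X x i (m + 1) then [(x.1, Function.update x.2 i (m + 1))] else [] := by
  simp only [extensions, List.range_succ, List.filter_append, List.map_append]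
  congr 1
  by_cases h : IsAllowed G X x i (m + 1) <;> simp [h]

theorem mem_extensions {i : Fin n} {x y : Fin N × (Fin n → ℕ)} :
    y ∈ extensions G X i d x ↔ ∃ c, 1 ≤ c ∧ c ≤ d ∧ IsAllowed G X x i c ∧
      y = (x.1, Function.update x.2 i c) := by
  simp only [extensions, List.mem_map, List.mem_filter, List.mem_range, decide_eq_true_eq]
  constructor
  · rintro ⟨j, ⟨hj, h⟩, rfl⟩
    exact ⟨j + 1, by omega, by omega, h, rfl⟩
  · rintro ⟨c, h₁, h₂, h, rfl⟩
    obtain ⟨j, rfl⟩ : ∃ j, c = j + 1 := ⟨c - 1, by omega⟩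
    exact ⟨j, ⟨by omega, h⟩, rfl⟩

/-- The empty coloring of the node `t` keeps the index `t`; this is how the output routine locates
the item of the root. -/
theorem items_zero_prefix (m : ℕ) : items G X d 0 <+: items G X d m := by
  induction m with
  | zero => exact List.prefix_rfl
  | succ m ih =>
    rw [items.eq_2]
    split_ifs
    · exact ih.trans (List.prefix_append _ _)
    · exact ih

/-- Completeness of the list: removing the color of vertex `m` turns an item of level `m + 1` into
one of level `m`, from which it arises by an allowed extension. -/
theorem mem_items {m : ℕ} {x : Fin N × (Fin n → ℕ)} :
    x ∈ items G X d m ↔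
      IsPartialColoring G d x.2 ∧ ∀ v, x.2 v ≠ 0 → v ∈ X x.1 ∧ (v : ℕ) < m := by
  induction m generalizing x with
  | zero =>
    obtain ⟨t, f⟩ := x
    simp only [items, List.mem_map, List.mem_finRange, true_and, Prod.mk.injEq]
    constructor
    · rintro ⟨_, rfl, rfl⟩
      simp [IsPartialColoring]
    · rintro ⟨-, h⟩
      refine ⟨t, rfl, funext fun v => ?_⟩
      by_contra hv
      exact absurd (h v (Ne.symm hv)).2 (Nat.not_lt_zero _)
  | succ m ih =>
    rw [items]
    split_ifs with hm
    · rw [List.mem_append, List.mem_flatMap, ih]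
      constructor
      · rintro (⟨h₁, h₂⟩ | ⟨y, hy, hx⟩)
        · exact ⟨h₁, fun v hv => ⟨(h₂ v hv).1, (h₂ v hv).2.trans (Nat.lt_succ_self m)⟩⟩
        · obtain ⟨h₁, h₂⟩ := ih.1 hy
          obtain ⟨c, hc, hcd, ⟨hi, hu⟩, rfl⟩ := mem_extensions.1 hx
          refine ⟨⟨fun v => ?_, fun u v huv => ?_⟩, fun v => ?_⟩
          · by_cases hv : v = ⟨m, hm⟩
            · simpa [hv] using hcd
            · simpa [hv] using h₁.1 v
          · by_cases hv : v = ⟨m, hm⟩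
            · have hne : u ≠ ⟨m, hm⟩ := fun h => huv.ne (h.trans hv.symm)
              subst hv
              have := hu u
              simp_all [huv.symm]
            · by_cases hu' : u = ⟨m, hm⟩
              · subst hu'
                have := hu v
                simp_all [eq_comm]
              · simpa [hv, hu'] using h₁.2 u v huv
          · by_cases hv : v = ⟨m, hm⟩
            · subst hv
              simp [hi]
            · simp only [ne_eq, hv, not_false_eq_true, Function.update_of_ne]
              exact fun h => ⟨(h₂ v h).1, (h₂ v h).2.trans (Nat.lt_succ_self m)⟩
      · rintro ⟨h₁, h₂⟩
        obtain ⟨t, f⟩ := x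
        dsimp only at h₁ h₂
        by_cases hf : f ⟨m, hm⟩ = 0
        · refine .inl ⟨h₁, fun v hv => ⟨(h₂ v hv).1, lt_of_le_of_ne
            (Nat.lt_succ_iff.1 (h₂ v hv).2) fun h => hv ?_⟩⟩
          obtain rfl : v = ⟨m, hm⟩ := Fin.ext h
          exact hf
        · refine .inr ⟨(t, Function.update f ⟨m, hm⟩ 0), ih.2 ⟨⟨fun v => ?_, fun u v huv => ?_⟩,
            fun v => ?_⟩, mem_extensions.2 ⟨f ⟨m, hm⟩, by omega, h₁.1 _, ⟨(h₂ _ hf).1, ?_⟩, ?_⟩⟩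
          · by_cases hv : v = ⟨m, hm⟩
            · simp [hv]
            · simpa [hv] using h₁.1 v
          · by_cases hu' : u = ⟨m, hm⟩
            · simp [hu']
            · by_cases hv : v = ⟨m, hm⟩
              · simp [hu', hv]
              · simpa [hv, hu'] using h₁.2 u v huv
          · by_cases hv : v = ⟨m, hm⟩
            · simp [hv]
            · simp only [ne_eq, hv, not_false_eq_true, Function.update_of_ne]
              exact fun h => ⟨(h₂ v h).1, lt_of_le_of_ne (Nat.lt_succ_iff.1 (h₂ v h).2)
                fun h => hv (Fin.ext h)⟩
          · rintro u ⟨hu, huv⟩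
            dsimp only at hu
            rw [Function.update_of_ne huv.ne'] at hu
            exact h₁.2 _ _ huv hf hu.symm
          · simp
    · rw [ih]
      refine and_congr_right fun _ => forall_congr' fun v => imp_congr_right fun _ =>
        and_congr_right fun _ => ?_
      have := v.2
      omega

/-- Needed to bound the length by a number of colorings. Items of level `m` leave vertex `m`
uncolored, so new items differ from old ones and determine the item they came from. -/
theorem nodup_items (m : ℕ) : (items G X d m).Nodup := by
  induction m with
  | zero =>
    exact (List.nodup_finRange N).map fun a b h => (Prod.mk.inj h).1
  | succ m ih =>
    rw [items]
    split_ifs with hm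
    · have h0 : ∀ x ∈ items G X d m, x.2 ⟨m, hm⟩ = 0 := fun x hx => by
        by_contra h
        exact absurd ((mem_items.1 hx).2 _ h).2 (lt_irrefl m)
      refine List.Nodup.append ih (List.nodup_flatMap.2 ⟨fun x _ => ?_, ?_⟩) ?_
      · refine List.Nodup.map (fun a b h => ?_) (List.nodup_range.filter _)
        simpa using congr_fun (Prod.mk.inj h).2 ⟨m, hm⟩
      · refine ih.imp_of_mem fun {x y} hx hy hxy => ?_
        rw [Function.onFun, List.disjoint_left]
        intro z hz hz'
        obtain ⟨c, -, -, -, rfl⟩ := mem_extensions.1 hz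
        obtain ⟨c', -, -, -, h⟩ := mem_extensions.1 hz'
        obtain ⟨h₁, h₂⟩ := Prod.mk.inj h
        refine hxy (Prod.ext h₁ (funext fun v => ?_))
        by_cases hv : v = ⟨m, hm⟩
        · rw [hv, h0 x hx, h0 y hy]
        · simpa [hv] using congr_fun h₂ v
      · rw [List.disjoint_left]
        intro z hz hz'
        obtain ⟨x, -, hx⟩ := List.mem_flatMap.1 hz'
        obtain ⟨c, hc, -, -, rfl⟩ := mem_extensions.1 hx
        have := h0 _ hz
        simp only [Function.update_self] at this
        omega
    · exact ih

theorem length_items_le_succ (m : ℕ) : (items G X d m).length ≤ (items G X d (m + 1)).length := by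
  rw [items]
  split_ifs
  · simp
  · exact le_rfl

theorem length_items_mono : Monotone fun m => (items G X d m).length :=
  monotone_nat_of_le_succ length_items_le_succ

theorem length_items_le {k : ℕ} (hk : IsAlmostChordal k G X) (m : ℕ) :
    (items G X d m).length ≤ ((n + 1) * 2 ^ (Nat.sqrt (2 * k) + 1)) ^ d * N := by
  classical
  rw [← List.toFinset_card_of_nodup (nodup_items m)]
  have := Finset.card_le_mul_card_image_of_maps_to (s := (items G X d m).toFinset)
    (t := Finset.univ) (f := Prod.fst) (fun _ _ => Finset.mem_univ _)
    (((n + 1) * 2 ^ (Nat.sqrt (2 * k) + 1)) ^ d) fun t _ => ?_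
  · simpa using this
  · rw [← Finset.card_image_of_injOn (f := Prod.snd)]
    · have := card_partialColorings_le (d := d) (hk t)
        (Finset.image Prod.snd {a ∈ (items G X d m).toFinset | a.1 = t}) fun f hf => ?_
      · simpa using this
      · simp only [Finset.mem_image, Finset.mem_filter, List.mem_toFinset, mem_items] at hf
        obtain ⟨x, ⟨⟨h₁, h₂⟩, rfl⟩, rfl⟩ := hf
        exact ⟨h₁, fun v hv => (h₂ v hv).1⟩
    · intro x hx y hy h
      simp only [Finset.coe_filter, Set.mem_ofPred_eq] at hx hy
      exact Prod.ext (hx.2.trans hy.2.symm) h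

end Items

/-- Division with remainder by `b` recovers row and column from the address. -/
theorem matrixOf_eq_one_iff {a b : ℕ} {R : Fin a → Fin b → Prop} (i : Fin a) (j : Fin b) :
    matrixOf R (i * b + j) = 1 ↔ R i j := by
  classical
  have h : (∃ (i' : Fin a) (j' : Fin b), R i' j' ∧ (i : ℕ) * b + j = (i' : ℕ) * b + j') ↔
      R i j := by
    constructor
    · rintro ⟨i', j', hR, h⟩
      have hb : 0 < b := j.pos
      have hdiv := congr_arg (· / b) h
      have hmod := congr_arg (· % b) h
      simp only [Nat.mul_comm _ b, Nat.mul_add_div hb, Nat.div_eq_of_lt j.2,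
        Nat.div_eq_of_lt j'.2, Nat.mul_add_mod, Nat.mod_eq_of_lt j.2, Nat.mod_eq_of_lt j'.2,
        add_zero] at hdiv hmod
      rwa [Fin.ext hdiv, Fin.ext hmod]
    · exact fun hR => ⟨i, j, hR, rfl⟩
  rw [← h]
  unfold matrixOf
  split_ifs with h' <;> simp [h']

/-! ### The program

The scalars `4, …, 19` hold: `4` the outer counter `i`, `5` the number `i * n`, `6` the end of the
list of items, `7` its end before the current round, `8` the current item, `9` the current color
minus one, `10` a truth value, `11` the inner counter, `12` the current round, `13` a node `s`,
`14` the number `s * n`, `15` and `16` the numbers `t * n` and `t * N` for the node `t` of the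
current item, `17` the best item of `s`, `18` a candidate for it, `19` the item of the root.
An item is represented by a multiple `q` of `n`.  Its coloring is stored in array `4` at
`q, …, q + n - 1`, the best extension in array `7` at the same place and its weight in the real
array `1` at `q`; arrays `5` and `6` hold `t * n` and `t * N` at `q`. -/

namespace RAM

def capProg : Prog := .ite (.nle (.var 0) (.var 1)) .skip (.setN 0 (.var 1))

/-- One item with the empty coloring for each node. Without multiplication, `t * n` and `t * N` are
built by repeated addition; `t * n` is here both the address of the item and the row offset of its
node. -/
def initProg : Prog :=
  .count 4 (.var 2) (.lit 1)
    (.seq (.putN 5 (.var 6) (.var 6))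
    (.seq (.putN 6 (.var 6) (.var 16))
    (.seq (.setN 16 (.add (.var 16) (.var 2)))
      (.setN 6 (.add (.var 6) (.var 1))))))

def testProg : Prog :=
  .seq (.setN 10 (.get 2 (.add (.get 5 (.var 8)) (.var 4))))
    (.count 11 (.var 1) (.lit 1)
      (.ite (.and (.neq (.get 4 (.add (.var 8) (.var 11))) (.add (.var 9) (.lit 1)))
          (.neq (.get 0 (.add (.var 5) (.var 11))) (.lit 1)))
        (.setN 10 (.lit 0)) .skip))

def copyItemProg : Prog :=
  .count 11 (.var 1) (.lit 1)
    (.putN 4 (.add (.var 6) (.var 11)) (.get 4 (.add (.var 8) (.var 11))))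

def pushProg : Prog :=
  .ite (.neq (.var 10) (.lit 1))
    (.seq (.putN 5 (.var 6) (.get 5 (.var 8)))
    (.seq (.putN 6 (.var 6) (.get 6 (.var 8)))
    (.seq copyItemProg
    (.seq (.putN 4 (.add (.var 6) (.var 4)) (.add (.var 9) (.lit 1)))
      (.setN 6 (.add (.var 6) (.var 1)))))))
    .skip

def extendItemProg : Prog := .count 9 (.var 0) (.lit 1) (.seq testProg pushProg)

def extendAllProg : Prog :=
  .seq (.setN 7 (.var 6)) (.count 8 (.var 7) (.var 1) extendItemProg)

def itemsProg : Prog :=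
  .seq (.setN 5 (.lit 0))
    (.count 4 (.var 1) (.lit 1) (.seq extendAllProg (.setN 5 (.add (.var 5) (.var 1)))))

def agreeProg : Prog :=
  .seq (.setN 10 (.lit 1))
    (.count 11 (.var 1) (.lit 1)
      (.ite (.and (.and (.neq (.get 2 (.add (.var 15) (.var 11))) (.lit 1))
            (.neq (.get 2 (.add (.var 14) (.var 11))) (.lit 1)))
          (.not (.neq (.get 4 (.add (.var 18) (.var 11))) (.get 4 (.add (.var 8) (.var 11))))))
        (.setN 10 (.lit 0)) .skip))

/-- The end of the list, held in scalar `6`, is no item and serves in scalar `17` as the mark for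
"no candidate yet". The negated conjunction expresses: no candidate yet, or the new one is at least
as heavy. -/
def findProg : Prog :=
  .seq (.setN 17 (.var 6))
    (.count 18 (.var 6) (.var 1)
      (.seq agreeProg
        (.ite (.and (.neq (.get 5 (.var 18)) (.var 14))
            (.and (.neq (.var 10) (.lit 1))
              (.not (.and (.not (.neq (.var 17) (.var 6)))
                (.not (.rle (.get 1 (.var 17)) (.get 1 (.var 18))))))))
          (.setN 17 (.var 18)) .skip)))

def mergeProg : Prog :=
  .count 11 (.var 1) (.lit 1)
    (.ite (.neq (.get 7 (.add (.var 8) (.var 11))) (.lit 0))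
      (.putN 7 (.add (.var 8) (.var 11)) (.get 7 (.add (.var 17) (.var 11)))) .skip)

def weighProg : Prog :=
  .seq (.setR 0 .zero)
  (.seq (.count 11 (.var 1) (.lit 1)
    (.ite (.neq (.get 7 (.add (.var 8) (.var 11))) (.lit 0)) .skip
      (.setR 0 (.add (.var 0) (.get 0 (.var 11))))))
    (.putR 1 (.var 8) (.var 0)))

def copyProg : Prog :=
  .count 11 (.var 1) (.lit 1)
    (.putN 7 (.add (.var 8) (.var 11)) (.get 4 (.add (.var 8) (.var 11))))

def childrenProg : Prog :=
  .seq (.setN 14 (.lit 0))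
    (.count 13 (.var 2) (.lit 1)
      (.seq (.ite (.neq (.get 1 (.add (.var 16) (.var 13))) (.lit 1))
          (.seq findProg mergeProg) .skip)
        (.setN 14 (.add (.var 14) (.var 1)))))

def processProg : Prog :=
  .seq (.setN 15 (.get 5 (.var 8)))
  (.seq (.setN 16 (.get 6 (.var 8)))
  (.seq copyProg
  (.seq childrenProg weighProg)))

/-- All items are recomputed `N` times, which replaces a traversal from the leaves to the root: each
round makes one more level of depth correct. -/
def solveProg : Prog :=
  .count 12 (.var 2) (.lit 1) (.count 8 (.var 6) (.var 1) processProg)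

def outputProg : Prog :=
  .seq (.setN 19 (.lit 0))
  (.seq (.count 4 (.var 3) (.lit 1) (.setN 19 (.add (.var 19) (.var 1))))
    (.count 11 (.var 1) (.lit 1)
      (.ite (.neq (.get 7 (.add (.var 19) (.var 11))) (.lit 0)) .skip
        (.putN 3 (.var 11) (.lit 1)))))

def mainProg : Prog :=
  .seq capProg (.seq initProg (.seq itemsProg (.seq solveProg outputProg)))

end RAM

/-! ### Correctness of the program, routine by routine -/

section Correctness

open RAM

variable {d n N : ℕ} {G : SimpleGraph (Fin n)} {w : Fin n → ℝ} {T : SimpleGraph (Fin N)}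
  {r : Fin N} {X : Fin N → Set (Fin n)} {Z : ℕ} {L : List (Fin N × (Fin n → ℕ))}

/-- The input is in its place. -/
structure HoldsInput (d : ℕ) (G : SimpleGraph (Fin n)) (w : Fin n → ℝ) (T : SimpleGraph (Fin N))
    (r : Fin N) (X : Fin N → Set (Fin n)) (s : State) : Prop where
  colors : s.nvar 0 = d
  vertices : s.nvar 1 = n
  nodes : s.nvar 2 = N
  root : s.nvar 3 = r
  adj : ∀ i j : Fin n, s.narr 0 (i * n + j) = 1 ↔ G.Adj i j
  child : ∀ i j : Fin N, s.narr 1 (i * N + j) = 1 ↔ IsChild T r i j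
  bag : ∀ (t : Fin N) (v : Fin n), s.narr 2 (t * n + v) = 1 ↔ v ∈ X t
  weight : ∀ v : Fin n, s.rarr 0 v = w v

theorem HoldsInput.frame {p : Prog} {s s' : State} (h : HoldsInput d G w T r X s)
    (hF : Frame p s s')
    (hp : (0 ∉ p.nvars ∧ 1 ∉ p.nvars ∧ 2 ∉ p.nvars ∧ 3 ∉ p.nvars) ∧
      (0 ∉ p.narrs ∧ 1 ∉ p.narrs ∧ 2 ∉ p.narrs) ∧ 0 ∉ p.rarrs) :
    HoldsInput d G w T r X s' := by
  obtain ⟨⟨h₀, h₁, h₂, h₃⟩, ⟨h₄, h₅, h₆⟩, h₇⟩ := hp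
  constructor
  · rw [hF.nvar _ h₀, h.colors]
  · rw [hF.nvar _ h₁, h.vertices]
  · rw [hF.nvar _ h₂, h.nodes]
  · rw [hF.nvar _ h₃, h.root]
  · rw [hF.narr _ h₄]; exact h.adj
  · rw [hF.narr _ h₅]; exact h.child
  · rw [hF.narr _ h₆]; exact h.bag
  · rw [hF.rarr _ h₇]; exact h.weight

/-- The memory holds the list `L` of items. -/
structure HoldsItems (L : List (Fin N × (Fin n → ℕ))) (s : State) : Prop where
  length : s.nvar 6 = L.length * n
  node : ∀ (i : ℕ) (h : i < L.length), s.narr 5 (i * n) = L[i].1 * n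
  node' : ∀ (i : ℕ) (h : i < L.length), s.narr 6 (i * n) = L[i].1 * N
  color : ∀ (i : ℕ) (h : i < L.length) (v : Fin n), s.narr 4 (i * n + v) = L[i].2 v

theorem HoldsItems.frame {p : Prog} {s s' : State} (h : HoldsItems L s) (hF : Frame p s s')
    (hp : 6 ∉ p.nvars ∧ 4 ∉ p.narrs ∧ 5 ∉ p.narrs ∧ 6 ∉ p.narrs) : HoldsItems L s' := by
  obtain ⟨h₁, h₂, h₃, h₄⟩ := hp
  constructor
  · rw [hF.nvar _ h₁, h.length]
  · rw [hF.narr _ h₃]; exact h.node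
  · rw [hF.narr _ h₄]; exact h.node'
  · rw [hF.narr _ h₂]; exact h.color

theorem HoldsItems.of_eq {s s' : State} (h : HoldsItems L s) (h₁ : s'.nvar 6 = s.nvar 6)
    (h₂ : s'.narr = s.narr) : HoldsItems L s' := by
  constructor
  · rw [h₁, h.length]
  · rw [h₂]; exact h.node
  · rw [h₂]; exact h.node'
  · rw [h₂]; exact h.color

theorem run_initProg (hZ : 1 ≤ Z) (hNZ : N ≤ Z) (hn : 1 ≤ n) {s : State}
    (hs : HoldsInput d G w T r X s) (h6 : s.nvar 6 = 0) (h16 : s.nvar 16 = 0)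
    (h4 : ∀ a, s.narr 4 a = 0) :
    Run Z initProg s (HoldsItems (items G X d 0)) := by
  refine Run.count hZ (fun j s' => s'.nvar 6 = j * n ∧ s'.nvar 16 = j * N ∧
      ∀ i < j, s'.narr 5 (i * n) = i * n ∧ s'.narr 6 (i * n) = i * N) N 1 le_rfl hNZ
    ?_ (fun _ _ => rfl) (by decide) ?_ ⟨by simpa using h6, by simpa using h16, by simp⟩ ?_ ?_
  · intro s' hF
    simp [NExp.eval, hF.nvar 2 (by decide), hs.nodes]
  · rintro j s v ⟨h₁, h₂, h₃⟩
    exact ⟨h₁, h₂, h₃⟩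
  · rintro j hj s' hF - ⟨h₁, h₂, h₃⟩
    have e₁ := hF.nvar 1 (by decide)
    have e₂ := hF.nvar 2 (by decide)
    rw [hs.vertices] at e₁
    rw [hs.nodes] at e₂
    refine Run.seq hZ (Run.putN (Run.seq hZ (Run.putN (Run.seq hZ (Run.setN (Run.setN ?_))))))
    refine ⟨?_, ?_, fun i hi => ?_⟩
    · simp [State.setN, State.putN, NExp.eval, h₁, e₁, add_mul]
    · simp [State.setN, State.putN, NExp.eval, h₂, e₂, add_mul]
    · have hij : i = j ↔ i * n = j * n := (Nat.mul_left_inj (by omega)).symm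
      by_cases h : i = j
      · subst h
        simp [State.setN, State.putN, NExp.eval, h₁, h₂]
      · have := h₃ i (by omega)
        simpa [State.setN, State.putN, NExp.eval, h₁, h₂, h, hij.not.1 h, show n ≠ 0 by omega]
  · rintro s' hF ⟨h₁, h₂, h₃⟩
    have hlen : (items G X d 0).length = N := by simp [items]
    constructor
    · rw [h₁, hlen]
    · intro i hi
      rw [(h₃ i (hlen ▸ hi)).1]
      simp [items]
    · intro i hi
      rw [(h₃ i (hlen ▸ hi)).2]
      simp [items]
    · intro i hi v
      rw [hF.narr 4 (by decide), h4]
      simp [items]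

theorem forall_fin_lt_succ {m : ℕ} (hm : m < n) (P : Fin n → Prop) :
    (∀ u : Fin n, (u : ℕ) < m + 1 → P u) ↔ (∀ u : Fin n, (u : ℕ) < m → P u) ∧ P ⟨m, hm⟩ :=
  ⟨fun h => ⟨fun u hu => h u (by omega), h _ (Nat.lt_succ_self m)⟩, fun h u hu =>
    (Nat.lt_succ_iff_lt_or_eq.1 hu).elim (h.1 u) fun hu => (Fin.ext hu : u = ⟨m, hm⟩) ▸ h.2⟩

theorem run_testProg (hZ : 1 ≤ Z) (hnZ : n ≤ Z) {s : State}
    (hs : HoldsInput d G w T r X s) (hL : HoldsItems L s) {q j : ℕ} {i : Fin n}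
    (hq : q < L.length) (h4 : s.nvar 4 = i) (h5 : s.nvar 5 = i * n) (h8 : s.nvar 8 = q * n)
    (h9 : s.nvar 9 = j) :
    Run Z testProg s fun s' => s'.nvar 10 = 1 ↔ IsAllowed G X L[q] i (j + 1) := by
  refine Run.seq hZ (Run.setN ?_)
  refine Run.count hZ (fun m s' => s'.nvar 10 = 1 ↔ i ∈ X L[q].1 ∧
      ∀ u : Fin n, (u : ℕ) < m → ¬ (L[q].2 u = j + 1 ∧ G.Adj i u)) n 1 le_rfl hnZ
    ?_ (fun _ _ => rfl) (by decide) ?_ ?_ ?_ ?_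
  · intro s' hF
    simp [NExp.eval, hF.nvar 1 (by decide), State.setN, hs.vertices]
  · intro m s v h
    exact h
  · simp [State.setN, NExp.eval, h4, h8, hL.node q hq, hs.bag]
  · rintro m hm s' hF h11 h
    have e₁ := hF.nvar 8 (by decide)
    have e₂ := hF.nvar 9 (by decide)
    have e₃ := hF.nvar 5 (by decide)
    have e₄ := hF.narr 4 (by decide)
    have e₅ := hF.narr 0 (by decide)
    simp only [State.setN, ne_eq, Nat.reduceEqDiff, not_false_eq_true,
      Function.update_of_ne, h8, h9, h5] at e₁ e₂ e₃ e₄ e₅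
    have hc := hL.color q hq ⟨m, hm⟩
    have ha := hs.adj i ⟨m, hm⟩
    dsimp only at hc ha
    simp only [forall_fin_lt_succ hm]
    refine Run.ite hZ (fun hb => Run.setN ?_) (fun hb => Run.skip ?_)
    · simp only [BExp.Holds, NExp.eval, e₁, e₂, e₃, e₄, e₅, h11, mul_one, hc, ha] at hb
      simp [State.setN, NExp.eval, hb]
    · simp only [BExp.Holds, NExp.eval, e₁, e₂, e₃, e₄, e₅, h11, mul_one, hc, ha] at hb
      rw [h]
      tauto
  · rintro s' hF h
    rw [h]
    simp [IsAllowed]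

theorem run_copyItemProg (hZ : 1 ≤ Z) (hnZ : n ≤ Z) {s : State} (h1 : s.nvar 1 = n) {q e : ℕ}
    (h6 : s.nvar 6 = e) (h8 : s.nvar 8 = q) (hqe : q + n ≤ e) :
    Run Z copyItemProg s fun s' => (∀ a < e, s'.narr 4 a = s.narr 4 a) ∧
      ∀ v < n, s'.narr 4 (e + v) = s.narr 4 (q + v) := by
  refine Run.count hZ (fun m s' => (∀ a < e, s'.narr 4 a = s.narr 4 a) ∧
      ∀ v < m, s'.narr 4 (e + v) = s.narr 4 (q + v)) n 1 le_rfl hnZ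
    ?_ (fun _ _ => rfl) (by decide) (fun _ _ _ h => h) ⟨fun _ _ => rfl, by simp⟩ ?_
    (fun s' _ h => h)
  · intro s' hF
    simp [NExp.eval, hF.nvar 1 (by decide), h1]
  · rintro m hm s' hF h11 ⟨h₁, h₂⟩
    have e₁ := hF.nvar 6 (by decide)
    have e₂ := hF.nvar 8 (by decide)
    refine Run.putN ⟨fun a ha => ?_, fun v hv => ?_⟩
    · simp only [State.putN, NExp.eval, e₁, h6, h11, mul_one, Function.update_self]
      rw [Function.update_of_ne (by omega), h₁ a ha]
    · simp only [State.putN, NExp.eval, e₁, e₂, h6, h8, h11, mul_one, Function.update_self]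
      by_cases h : v = m
      · subst h
        -- The source block ends at or before `e`, so copying has not altered it.
        rw [Function.update_self, h₁ _ (by omega)]
      · rw [Function.update_of_ne (by omega), h₂ v (by omega)]

/-- The conditional singleton is the summand in `extensions_succ`, so one round of the color loop
matches one step of that recursion. -/
theorem run_pushProg (hZ : 1 ≤ Z) (hnZ : n ≤ Z) {s : State}
    (hs : HoldsInput d G w T r X s) (hL : HoldsItems L s) {q j : ℕ} {i : Fin n}
    (hq : q < L.length) (h4 : s.nvar 4 = i) (h8 : s.nvar 8 = q * n)
    (h9 : s.nvar 9 = j) {P : Prop} [Decidable P] (h10 : s.nvar 10 = 1 ↔ P) :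
    Run Z pushProg s
      (HoldsItems (L ++ if P then [(L[q].1, Function.update L[q].2 i (j + 1))] else [])) := by
  refine Run.ite hZ (fun hb => ?_) (fun hb => Run.skip ?_)
  · have hP : P := by simpa [BExp.Holds, NExp.eval, h10] using hb
    rw [if_pos hP]
    have hn : 0 < n := i.pos
    have hle : ∀ {a}, a < L.length → a * n + n ≤ L.length * n := fun ha => by
      rw [← Nat.succ_mul]
      exact Nat.mul_le_mul_right _ ha
    refine Run.seq hZ (Run.putN (Run.seq hZ (Run.putN (Run.seq hZ ?_))))
    refine (run_copyItemProg hZ hnZ (by simpa [State.putN] using hs.vertices)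
      (by simpa [State.putN] using hL.length) (by simpa [State.putN] using h8)
      (hle hq)).mono_frame ?_
    rintro s' hF ⟨hlow, hrow⟩
    have e₁ := hF.nvar 6 (by decide)
    have e₂ := hF.nvar 4 (by decide)
    have e₃ := hF.nvar 9 (by decide)
    have e₄ := hF.nvar 1 (by decide)
    have e₅ := hF.narr 5 (by decide)
    have e₆ := hF.narr 6 (by decide)
    simp only [State.putN, NExp.eval, hL.length, h4, h9, hs.vertices, h8, hL.node q hq,
      hL.node' q hq, ne_eq, Nat.reduceEqDiff, not_false_eq_true,
      Function.update_of_ne, Function.update_self] at e₁ e₂ e₃ e₄ e₅ e₆ hlow hrow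
    refine Run.seq hZ (Run.putN (Run.setN ?_))
    have hlen : ∀ {a}, a < (L ++ [(L[q].1, Function.update L[q].2 i (j + 1))]).length →
        a < L.length ∨ a = L.length := fun ha => by simp at ha; omega
    constructor
    · simp [State.setN, State.putN, NExp.eval, e₁, e₄, add_mul]
    · intro a ha
      simp only [State.setN, State.putN, NExp.eval, ne_eq, Nat.reduceEqDiff,
        not_false_eq_true, Function.update_of_ne, e₅]
      rcases hlen ha with ha | rfl
      · have := hle ha
        rw [Function.update_of_ne (by omega), hL.node a ha, List.getElem_append_left ha]
      · simp
    · intro a ha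
      simp only [State.setN, State.putN, NExp.eval, ne_eq, Nat.reduceEqDiff,
        not_false_eq_true, Function.update_of_ne, e₆]
      rcases hlen ha with ha | rfl
      · have := hle ha
        rw [Function.update_of_ne (by omega), hL.node' a ha, List.getElem_append_left ha]
      · simp
    · intro a ha v
      simp only [State.setN, State.putN, NExp.eval, e₁, e₂, e₃, Function.update_self]
      have hv := v.2
      rcases hlen ha with ha | rfl
      · have := hle ha
        rw [Function.update_of_ne (by omega), hlow _ (by omega), hL.color a ha,
          List.getElem_append_left ha]
      · rw [List.getElem_append_right le_rfl]
        simp only [Nat.sub_self, List.getElem_cons_zero]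
        by_cases h : v = i
        · subst h
          simp
        · have hne : (v : ℕ) ≠ i := fun h' => h (Fin.ext h')
          rw [Function.update_of_ne (by omega), Function.update_of_ne h, hrow v hv, hL.color q hq]
  · have hP : ¬ P := by simpa [BExp.Holds, NExp.eval, h10] using hb
    simpa [hP] using hL

theorem run_extendItemProg (hZ : 1 ≤ Z) (hnZ : n ≤ Z) (hdZ : d ≤ Z) {s : State}
    (hs : HoldsInput d G w T r X s) (hL : HoldsItems L s) {q : ℕ} {i : Fin n}
    (hq : q < L.length) (h4 : s.nvar 4 = i) (h5 : s.nvar 5 = i * n) (h8 : s.nvar 8 = q * n) :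
    Run Z extendItemProg s (HoldsItems (L ++ extensions G X i d L[q])) := by
  classical
  refine Run.count hZ (fun j => HoldsItems (L ++ extensions G X i j L[q])) d 1 le_rfl hdZ
    ?_ (fun _ _ => rfl) (by decide) (fun _ _ _ h => h.of_eq rfl rfl) ?_ ?_ (fun s' _ h => h)
  · intro s' hF
    simp [NExp.eval, hF.nvar 0 (by decide), hs.colors]
  · simpa [extensions] using hL.of_eq rfl rfl
  · rintro j hj s' hF h9 hI
    have hs' := hs.frame hF (by decide)
    have hq' : q < (L ++ extensions G X i j L[q]).length := by
      rw [List.length_append]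
      omega
    have hget : (L ++ extensions G X i j L[q])[q] = L[q] := List.getElem_append_left hq
    rw [mul_one] at h9
    have e₁ := (hF.nvar 4 (by decide)).trans h4
    have e₂ := (hF.nvar 8 (by decide)).trans h8
    refine Run.seq hZ ((run_testProg hZ hnZ hs' hI hq' e₁
      ((hF.nvar 5 (by decide)).trans h5) e₂ h9).mono_frame fun s'' hF' h10 => ?_)
    have := run_pushProg hZ hnZ (hs'.frame hF' (by decide)) (hI.frame hF' (by decide)) hq'
      ((hF'.nvar 4 (by decide)).trans e₁) ((hF'.nvar 8 (by decide)).trans e₂)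
      ((hF'.nvar 9 (by decide)).trans h9) h10
    rw [hget, List.append_assoc, ← extensions_succ] at this
    exact this

/-- The list grows while it is scanned, but only at its end: old indices stay valid, and the bound
in scalar `7` keeps the scan to the old items. -/
theorem run_extendAllProg (hZ : 1 ≤ Z) (hnZ : n ≤ Z) (hdZ : d ≤ Z) (hLZ : L.length ≤ Z)
    {s : State} (hs : HoldsInput d G w T r X s) (hL : HoldsItems L s) {i : Fin n}
    (h4 : s.nvar 4 = i) (h5 : s.nvar 5 = i * n) :
    Run Z extendAllProg s (HoldsItems (L ++ L.flatMap (extensions G X i d))) := by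
  refine Run.seq hZ (Run.setN ?_)
  have hs' : HoldsInput d G w T r X (s.setN 7 (NExp.eval s (.var 6))) :=
    hs.frame (Exec.setN 7 (.var 6) s).frame (by decide)
  refine Run.count hZ (fun m => HoldsItems (L ++ (L.take m).flatMap (extensions G X i d)))
    L.length n i.pos hLZ ?_ ?_ (by decide) (fun _ _ _ h => h.of_eq rfl rfl) ?_ ?_ ?_
  · intro s' hF
    simp [NExp.eval, hF.nvar 7 (by decide), State.setN, hL.length]
  · intro s' hF
    exact (hF.nvar 1 (by decide)).trans hs'.vertices
  · simp only [List.take_zero, List.flatMap_nil, List.append_nil]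
    exact hL.of_eq rfl rfl
  · rintro q hq s' hF h8 hI
    have := run_extendItemProg (q := q) hZ hnZ hdZ (hs'.frame hF (by decide)) hI
      (by rw [List.length_append]; omega)
      ((hF.nvar 4 (by decide)).trans (by simpa [State.setN] using h4))
      ((hF.nvar 5 (by decide)).trans (by simpa [State.setN] using h5)) h8
    rw [List.getElem_append_left hq] at this
    rw [List.take_succ_eq_append_getElem hq, List.flatMap_append, ← List.append_assoc]
    simpa using this
  · intro s' _ h
    simpa using h

theorem run_itemsProg (hZ : 1 ≤ Z) (hnZ : n ≤ Z) (hdZ : d ≤ Z)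
    (hLZ : (items G X d n).length ≤ Z) {s : State} (hs : HoldsInput d G w T r X s)
    (hL : HoldsItems (items G X d 0) s) :
    Run Z itemsProg s (HoldsItems (items G X d n)) := by
  refine Run.seq hZ (Run.setN ?_)
  have hs' : HoldsInput d G w T r X (s.setN 5 (NExp.eval s (.lit 0))) :=
    hs.frame (Exec.setN 5 (.lit 0) s).frame (by decide)
  refine Run.count hZ (fun m s' => HoldsItems (items G X d m) s' ∧ s'.nvar 5 = m * n)
    n 1 le_rfl hnZ ?_ (fun _ _ => rfl) (by decide) (fun _ _ _ h => ⟨h.1.of_eq rfl rfl, h.2⟩) ?_ ?_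
    (fun s' _ h => h.1)
  · intro s' hF
    exact (hF.nvar 1 (by decide)).trans (hs'.vertices.trans (mul_one n).symm)
  · exact ⟨hL.of_eq rfl rfl, by simp [State.setN, NExp.eval]⟩
  · rintro m hm s' hF h4 ⟨hI, h5⟩
    refine Run.seq hZ ((run_extendAllProg (i := ⟨m, hm⟩) hZ hnZ hdZ
      ((length_items_mono hm.le).trans hLZ) (hs'.frame hF (by decide)) hI (by simpa using h4)
      h5).mono_frame fun s'' hF' hI' => ?_)
    refine Run.setN ⟨?_, ?_⟩
    · rw [items, dif_pos hm]
      exact hI'.of_eq rfl rfl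
    · simp [State.setN, NExp.eval, hF'.nvar 5 (by decide), h5, hF'.nvar 1 (by decide),
        hF.nvar 1 (by decide), hs.vertices, add_mul]

/-! ### Correctness of the dynamic program -/

/-- The colorings `f` and `g` agree on the vertices that the bags of `t` and `t'` share. -/
def AgreeOnBags (X : Fin N → Set (Fin n)) (t t' : Fin N) (f g : Fin n → ℕ) : Prop :=
  ∀ v, v ∈ X t → v ∈ X t' → f v = g v

theorem run_agreeProg (hZ : 1 ≤ Z) (hnZ : n ≤ Z) {s : State}
    (hs : HoldsInput d G w T r X s) (hL : HoldsItems L s) {p q : ℕ} {t t' : Fin N}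
    (hp : p < L.length) (hq : q < L.length) (h8 : s.nvar 8 = q * n) (h14 : s.nvar 14 = t' * n)
    (h15 : s.nvar 15 = t * n) (h18 : s.nvar 18 = p * n) :
    Run Z agreeProg s fun s' => s'.nvar 10 = 1 ↔ AgreeOnBags X t t' L[p].2 L[q].2 := by
  refine Run.seq hZ (Run.setN ?_)
  refine Run.count hZ (fun m s' => s'.nvar 10 = 1 ↔
      ∀ v : Fin n, (v : ℕ) < m → v ∈ X t → v ∈ X t' → L[p].2 v = L[q].2 v) n 1 le_rfl hnZ
    ?_ (fun _ _ => rfl) (by decide) ?_ ?_ ?_ ?_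
  · intro s' hF
    simp [NExp.eval, hF.nvar 1 (by decide), State.setN, hs.vertices]
  · intro m s v h
    exact h
  · simp [State.setN, NExp.eval]
  · rintro m hm s' hF h11 h
    have e₁ := hF.nvar 8 (by decide)
    have e₂ := hF.nvar 14 (by decide)
    have e₃ := hF.nvar 15 (by decide)
    have e₄ := hF.nvar 18 (by decide)
    have e₅ := hF.narr 4 (by decide)
    have e₆ := hF.narr 2 (by decide)
    simp only [State.setN, ne_eq, Nat.reduceEqDiff, not_false_eq_true,
      Function.update_of_ne, h8, h14, h15, h18] at e₁ e₂ e₃ e₄ e₅ e₆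
    have c₁ := hL.color p hp ⟨m, hm⟩
    have c₂ := hL.color q hq ⟨m, hm⟩
    have b₁ := hs.bag t ⟨m, hm⟩
    have b₂ := hs.bag t' ⟨m, hm⟩
    dsimp only at c₁ c₂ b₁ b₂
    simp only [forall_fin_lt_succ hm]
    refine Run.ite hZ (fun hb => Run.setN ?_) (fun hb => Run.skip ?_)
    · simp only [BExp.Holds, NExp.eval, e₁, e₂, e₃, e₄, e₅, e₆, h11, mul_one, c₁, c₂, b₁, b₂] at hb
      simp [State.setN, NExp.eval, hb]
    · simp only [BExp.Holds, NExp.eval, e₁, e₂, e₃, e₄, e₅, e₆, h11, mul_one, c₁, c₂, b₁, b₂] at hb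
      rw [h]
      tauto
  · rintro s' hF h
    rw [h]
    simp [AgreeOnBags]

theorem run_findProg (hZ : 1 ≤ Z) (hnZ : n ≤ Z) (hn : 1 ≤ n) (hLZ : L.length ≤ Z) {s : State}
    (hs : HoldsInput d G w T r X s) (hL : HoldsItems L s) {q : ℕ} {t t' : Fin N}
    (hq : q < L.length) (h8 : s.nvar 8 = q * n) (h14 : s.nvar 14 = t' * n)
    (h15 : s.nvar 15 = t * n)
    (hex : ∃ (p : ℕ) (hp : p < L.length), L[p].1 = t' ∧ AgreeOnBags X t t' L[p].2 L[q].2) :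
    Run Z findProg s fun s' => ∃ (b : ℕ) (hb : b < L.length), s'.nvar 17 = b * n ∧
      L[b].1 = t' ∧ AgreeOnBags X t t' L[b].2 L[q].2 ∧
      ∀ (p : ℕ) (hp : p < L.length), L[p].1 = t' → AgreeOnBags X t t' L[p].2 L[q].2 →
        s.rarr 1 (p * n) ≤ s.rarr 1 (b * n) := by
  refine Run.seq hZ (Run.setN ?_)
  set s₁ := s.setN 17 (NExp.eval s (.var 6)) with hs₁
  have hF₁ := (Exec.setN 17 (.var 6) s).frame
  have hs' : HoldsInput d G w T r X s₁ := hs.frame hF₁ (by decide)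
  have hL' : HoldsItems L s₁ := hL.frame hF₁ (by decide)
  -- Either the mark `L.length * n` still stands and no item below `m` is a candidate, or scalar
  -- `17` points to a heaviest candidate among those items.
  refine Run.count hZ (fun m s' =>
      (s'.nvar 17 = L.length * n ∧ ∀ (p : ℕ) (hp : p < L.length), p < m →
        ¬ (L[p].1 = t' ∧ AgreeOnBags X t t' L[p].2 L[q].2)) ∨
      ∃ (b : ℕ) (hb : b < L.length), s'.nvar 17 = b * n ∧
      (L[b].1 = t' ∧ AgreeOnBags X t t' L[b].2 L[q].2) ∧
      ∀ (p : ℕ) (hp : p < L.length), p < m →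
        (L[p].1 = t' ∧ AgreeOnBags X t t' L[p].2 L[q].2) →
        s.rarr 1 (p * n) ≤ s.rarr 1 (b * n)) L.length n hn hLZ ?_ ?_ (by decide) ?_ ?_ ?_ ?_
  · intro s' hF
    simp [NExp.eval, hF.nvar 6 (by decide), hL'.length]
  · intro s' hF
    exact (hF.nvar 1 (by decide)).trans hs'.vertices
  · intro m s v h
    exact h
  · exact .inl ⟨by simp [hs₁, State.setN, NExp.eval, hL.length], by simp⟩
  · rintro m hm s' hF h18 hI
    have e₁ : s'.nvar 8 = q * n := (hF.nvar 8 (by decide)).trans ((hF₁.nvar 8 (by decide)).trans h8)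
    have e₂ : s'.nvar 14 = t' * n :=
      (hF.nvar 14 (by decide)).trans ((hF₁.nvar 14 (by decide)).trans h14)
    have hLs := hL'.frame hF (by decide)
    refine Run.seq hZ ((run_agreeProg hZ hnZ (hs'.frame hF (by decide)) hLs hm hq e₁ e₂
      ((hF.nvar 15 (by decide)).trans ((hF₁.nvar 15 (by decide)).trans h15))
      h18).mono_frame fun s'' hF' h10 => ?_)
    have g₁ := (hF'.nvar 14 (by decide)).trans e₂
    have g₂ := (hF'.nvar 18 (by decide)).trans h18
    have g₃ := hF'.nvar 17 (by decide)
    have g₄ := (hF'.nvar 6 (by decide)).trans hLs.length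
    have g₅ : s''.rarr 1 = s.rarr 1 := (hF'.rarr 1 (by decide)).trans (hF.rarr 1 (by decide))
    have g₆ := (hLs.frame hF' (by decide)).node m hm
    have hnode : L[m].1 * n = (t' : ℕ) * n ↔ L[m].1 = t' := by
      rw [Nat.mul_left_inj (by omega), Fin.ext_iff]
    have hlt : ∀ {p}, p < m + 1 ↔ p < m ∨ p = m := fun {p} => Nat.lt_succ_iff_lt_or_eq
    have hc : ∀ b < L.length, b * n ≠ L.length * n := fun b hb => by
      rw [Ne, Nat.mul_left_inj (by omega)]
      omega
    refine Run.ite hZ (fun hb => Run.setN (.inr ?_)) (fun hb => Run.skip ?_)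
    · simp only [BExp.Holds, NExp.eval, RExp.eval, g₁, g₂, g₃, g₄, g₅, g₆, h10, hnode] at hb
      refine ⟨m, hm, by simp [State.setN, NExp.eval, g₂], ⟨hb.1, hb.2.1⟩, fun p hp hpm hcand => ?_⟩
      rcases hlt.1 hpm with hpm | rfl
      · rcases hI with ⟨-, hI⟩ | ⟨b, hbL, h17, -, hI⟩
        · exact absurd hcand (hI p hp hpm)
        · have hle := hb.2.2
          rw [h17, not_and, not_not] at hle
          exact (hI p hp hpm hcand).trans (hle (hc b hbL))
      · exact le_rfl
    · simp only [BExp.Holds, NExp.eval, RExp.eval, g₁, g₂, g₃, g₄, g₅, g₆, h10, hnode] at hb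
      rcases hI with ⟨h17, hI⟩ | ⟨b, hbL, h17, hcb, hI⟩
      · refine .inl ⟨g₃.trans h17, fun p hp hpm hcand => ?_⟩
        rcases hlt.1 hpm with hpm | rfl
        · exact hI p hp hpm hcand
        · exact hb ⟨hcand.1, hcand.2, fun h => h.1 h17⟩
      · refine .inr ⟨b, hbL, g₃.trans h17, hcb, fun p hp hpm hcand => ?_⟩
        rcases hlt.1 hpm with hpm | rfl
        · exact hI p hp hpm hcand
        · by_contra hlt'
          refine hb ⟨hcand.1, hcand.2, fun h => h.2 ?_⟩
          rw [h17]
          exact (not_le.1 hlt').le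
  · rintro s' - (⟨-, h⟩ | ⟨b, hb, h17, hcb, h⟩)
    · obtain ⟨p, hp, hcand⟩ := hex
      exact absurd hcand (h p hp hp)
    · exact ⟨b, hb, h17, hcb.1, hcb.2, fun p hp h₁ h₂ => h p hp hp ⟨h₁, h₂⟩⟩

/-- The memories agree in array `7`, except on the `n` entries from `e` on. -/
def SameOutside (n e : ℕ) (s s' : State) : Prop :=
  ∀ a, a < e ∨ e + n ≤ a → s'.narr 7 a = s.narr 7 a

/-- The extension that is stored for the item of index `i`. -/
def row (n : ℕ) (s : State) (i : ℕ) : Fin n → ℕ := fun v => s.narr 7 (i * n + v)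

theorem SameOutside.row_eq {s s' : State} {q i : ℕ} (h : SameOutside n (q * n) s s')
    (hi : i ≠ q) : row n s' i = row n s i := by
  funext v
  refine h _ ?_
  have hv := v.2
  rcases Nat.lt_or_gt_of_ne hi with hi | hi
  · have := Nat.mul_le_mul_right n (Nat.succ_le_of_lt hi)
    rw [Nat.succ_mul] at this
    omega
  · have := Nat.mul_le_mul_right n (Nat.succ_le_of_lt hi)
    rw [Nat.succ_mul] at this
    omega

theorem run_copyProg (hZ : 1 ≤ Z) (hnZ : n ≤ Z) {s : State}
    (hs : HoldsInput d G w T r X s) (hL : HoldsItems L s) {q : ℕ} (hq : q < L.length)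
    (h8 : s.nvar 8 = q * n) :
    Run Z copyProg s fun s' => row n s' q = L[q].2 ∧ SameOutside n (q * n) s s' := by
  refine Run.count hZ (fun m s' => (∀ v : Fin n, (v : ℕ) < m → row n s' q v = L[q].2 v) ∧
      SameOutside n (q * n) s s') n 1 le_rfl hnZ
    ?_ (fun _ _ => rfl) (by decide) (fun _ _ _ h => h) ⟨by simp, fun _ _ => rfl⟩ ?_
    (fun s' _ h => ⟨funext fun v => h.1 v v.2, h.2⟩)
  · intro s' hF
    exact (hF.nvar 1 (by decide)).trans (hs.vertices.trans (mul_one n).symm)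
  · rintro m hm s' hF h11 ⟨h₁, h₂⟩
    have e₁ := (hF.nvar 8 (by decide)).trans h8
    have c := (hL.frame hF (by decide)).color q hq ⟨m, hm⟩
    dsimp only at c
    refine Run.putN ⟨?_, fun a ha => ?_⟩
    · rw [forall_fin_lt_succ hm]
      refine ⟨fun v hv => ?_, ?_⟩
      · simp only [row, State.putN, NExp.eval, e₁, h11, mul_one, Function.update_self]
        rw [Function.update_of_ne (by omega)]
        exact h₁ v hv
      · simp [row, State.putN, NExp.eval, e₁, h11, c]
    · simp only [State.putN, NExp.eval, e₁, h11, mul_one, Function.update_self]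
      rw [Function.update_of_ne (by omega)]
      exact h₂ a ha

theorem run_mergeProg (hZ : 1 ≤ Z) (hnZ : n ≤ Z) {s : State}
    (hs : HoldsInput d G w T r X s) {q b : ℕ} (hqb : b ≠ q)
    (h8 : s.nvar 8 = q * n) (h17 : s.nvar 17 = b * n) :
    Run Z mergeProg s fun s' => row n s' q = overlay (row n s q) (row n s b) ∧
      SameOutside n (q * n) s s' := by
  refine Run.count hZ (fun m s' =>
      (∀ v : Fin n, (v : ℕ) < m → row n s' q v = overlay (row n s q) (row n s b) v) ∧
      (∀ v : Fin n, m ≤ v → row n s' q v = row n s q v) ∧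
      SameOutside n (q * n) s s') n 1 le_rfl hnZ
    ?_ (fun _ _ => rfl) (by decide) (fun _ _ _ h => h)
    ⟨by simp, fun _ _ => rfl, fun _ _ => rfl⟩ ?_ (fun s' _ h => ⟨funext fun v => h.1 v v.2, h.2.2⟩)
  · intro s' hF
    exact (hF.nvar 1 (by decide)).trans (hs.vertices.trans (mul_one n).symm)
  · rintro m hm s' hF h11 ⟨h₁, h₂, h₃⟩
    have e₁ := (hF.nvar 8 (by decide)).trans h8
    have e₂ := (hF.nvar 17 (by decide)).trans h17
    have c₁ : s'.narr 7 (q * n + m) = row n s q ⟨m, hm⟩ := h₂ ⟨m, hm⟩ le_rfl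
    -- As `b ≠ q`, the row being read is disjoint from the row being written.
    have c₂ : s'.narr 7 (b * n + m) = row n s b ⟨m, hm⟩ := congr_fun (h₃.row_eq hqb) ⟨m, hm⟩
    simp only [forall_fin_lt_succ hm]
    refine Run.ite hZ (fun hb => Run.putN ⟨⟨fun v hv => ?_, ?_⟩, fun v hv => ?_, fun a ha => ?_⟩)
      (fun hb => Run.skip ⟨⟨h₁, ?_⟩, fun v hv => h₂ v (by omega), h₃⟩)
    · simp only [row, State.putN, NExp.eval, e₁, h11, mul_one, Function.update_self]
      rw [Function.update_of_ne (by omega)]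
      exact h₁ v hv
    · simp only [BExp.Holds, NExp.eval, e₁, h11, mul_one, c₁] at hb
      simp only [row, State.putN, NExp.eval, e₁, e₂, h11, mul_one, Function.update_self, c₂]
      simp only [overlay, hb, if_true]
      rfl
    · simp only [row, State.putN, NExp.eval, e₁, h11, mul_one, Function.update_self]
      rw [Function.update_of_ne (by omega)]
      exact h₂ v (by omega)
    · simp only [State.putN, NExp.eval, e₁, h11, mul_one, Function.update_self]
      rw [Function.update_of_ne (by omega)]
      exact h₃ a ha
    · simp only [BExp.Holds, NExp.eval, e₁, h11, mul_one, c₁] at hb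
      simp only [overlay, hb, if_false]
      exact c₁

theorem run_weighProg (hZ : 1 ≤ Z) (hnZ : n ≤ Z) {s : State}
    (hs : HoldsInput d G w T r X s) {q : ℕ} (h8 : s.nvar 8 = q * n) :
    Run Z weighProg s fun s' => s'.rarr 1 (q * n) = coloredWeight w (row n s' q) ∧
      ∀ a ≠ q * n, s'.rarr 1 a = s.rarr 1 a := by
  refine Run.seq hZ (Run.setR (Run.seq hZ ?_))
  refine Run.count hZ (fun m s' => s'.rvar 0 =
      ∑ v ∈ Finset.range m, if s.narr 7 (q * n + v) = 0 then 0 else s.rarr 0 v) n 1 le_rfl hnZ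
    ?_ (fun _ _ => rfl) (by decide) (fun _ _ _ h => h) (by simp [State.setR, RExp.eval]) ?_ ?_
  · intro s' hF
    exact (hF.nvar 1 (by decide)).trans (hs.vertices.trans (mul_one n).symm)
  · rintro m hm s' hF h11 h
    have e₁ : s'.nvar 8 = q * n := (hF.nvar 8 (by decide)).trans h8
    have e₂ : s'.narr 7 = s.narr 7 := hF.narr 7 (by decide)
    have e₃ : s'.rarr 0 = s.rarr 0 := hF.rarr 0 (by decide)
    rw [Finset.sum_range_succ]
    refine Run.ite hZ (fun hb => Run.skip ?_) (fun hb => Run.setR ?_)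
    · simp only [BExp.Holds, NExp.eval, e₁, e₂, h11, mul_one] at hb
      rw [if_pos hb, h, add_zero]
    · simp only [BExp.Holds, NExp.eval, e₁, e₂, h11, mul_one] at hb
      rw [if_neg hb]
      simp [State.setR, RExp.eval, NExp.eval, h, e₃, h11]
  · rintro s' hF h
    have e₁ : s'.nvar 8 = q * n := (hF.nvar 8 (by decide)).trans h8
    have e₂ : s'.narr 7 = s.narr 7 := hF.narr 7 (by decide)
    have e₃ : s'.rarr 1 = s.rarr 1 := hF.rarr 1 (by decide)
    refine Run.putR ⟨?_, fun a ha => ?_⟩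
    · simp only [State.putR, NExp.eval, RExp.eval, e₁, h, Function.update_self]
      rw [← Fin.sum_univ_eq_sum_range
        (fun v => if s.narr 7 (q * n + v) = 0 then 0 else s.rarr 0 v) n]
      simp only [coloredWeight, row, e₂, hs.weight]
    · simp only [State.putR, NExp.eval, e₁, Function.update_self]
      rw [Function.update_of_ne ha, e₃]

/-- The memory holds the best extension of the item `x`, which has the index `i`. -/
def IsSolved (d : ℕ) (G : SimpleGraph (Fin n)) (w : Fin n → ℝ) (T : SimpleGraph (Fin N))
    (r : Fin N) (X : Fin N → Set (Fin n)) (s : State) (i : ℕ) (x : Fin N × (Fin n → ℕ)) : Prop :=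
  IsOptimalExtension G d w (verticesBelow T r X x.1) (X x.1) x.2 (row n s i) ∧
    s.rarr 1 (i * n) = coloredWeight w (row n s i)

theorem IsOptimalExtension.overlay_child (hD : IsTreeDecomposition G T X) {t t' : Fin N}
    (htt' : IsChild T r t t') {A : Set (Fin N)} (hA : t' ∉ A) {f g F₁ F₂ : Fin n → ℕ}
    (h₁ : IsOptimalExtension G d w (verticesBelowPart T r X t A) (X t) f F₁)
    (h₂ : IsOptimalExtension G d w (verticesBelow T r X t') (X t') g F₂)
    (hgf : AgreeOnBags X t t' g f)
    (hbest : ∀ g', IsPartialColoring G d g' → (∀ v, g' v ≠ 0 → v ∈ X t') →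
      AgreeOnBags X t t' g' f → ∃ F',
        IsOptimalExtension G d w (verticesBelow T r X t') (X t') g' F' ∧
        coloredWeight w F' ≤ coloredWeight w F₂) :
    IsOptimalExtension G d w (verticesBelowPart T r X t (insert t' A)) (X t) f
      (_root_.overlay F₁ F₂) := by
  rw [verticesBelowPart_insert htt']
  have hXU : X t ⊆ verticesBelowPart T r X t A := Set.subset_union_left
  refine h₁.overlay hXU (subset_verticesBelow t')
    (fun v hv => hD.mem_of_mem_verticesBelowPart htt' hA hv.1 hv.2)
    (fun u _ v hv huv => (hD.mem_or_mem_of_adj htt' hv huv).imp_right (@hXU v)) h₂ hgf hbest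

theorem insert_setOf_lt {m : ℕ} (hm : m < N) :
    {t : Fin N | (t : ℕ) < m + 1} = insert ⟨m, hm⟩ {t : Fin N | (t : ℕ) < m} := by
  ext t
  simp only [Set.mem_ofPred_eq, Set.mem_insert_iff, Fin.ext_iff]
  omega

/-- Optimality is conditional on the items of the children being solved, since early rounds run on
unsolved ones; the memory outside the row is preserved in any case. After `m` rounds the children
among the nodes less than `m` have been glued on. -/
theorem run_childrenProg (hD : IsTreeDecomposition G T X) (hZ : 1 ≤ Z) (hnZ : n ≤ Z)
    (hNZ : N ≤ Z) (hn : 1 ≤ n) (hLZ : (items G X d n).length ≤ Z) {s : State}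
    (hs : HoldsInput d G w T r X s) (hL : HoldsItems (items G X d n) s) {q : ℕ} {t : Fin N}
    {f : Fin n → ℕ} (hq : q < (items G X d n).length) (hqt : (items G X d n)[q] = (t, f))
    (h8 : s.nvar 8 = q * n) (h15 : s.nvar 15 = t * n) (h16 : s.nvar 16 = t * N)
    (hrow : row n s q = f) :
    Run Z childrenProg s fun s' => SameOutside n (q * n) s s' ∧
      ((∀ (i : ℕ) (hi : i < (items G X d n).length), IsChild T r t (items G X d n)[i].1 →
        IsSolved d G w T r X s i (items G X d n)[i]) →
      IsOptimalExtension G d w (verticesBelow T r X t) (X t) f (row n s' q)) := by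
  obtain ⟨hf, hfX⟩ : IsPartialColoring G d f ∧ ∀ v, f v ≠ 0 → v ∈ X t := by
    have := (mem_items (G := G) (X := X) (d := d) (m := n)).1 (List.getElem_mem hq)
    rw [hqt] at this
    exact ⟨this.1, fun v hv => (this.2 v hv).1⟩
  refine Run.seq hZ (Run.setN ?_)
  set s₁ := s.setN 14 (NExp.eval s (.lit 0)) with hs₁
  have hF₁ := (Exec.setN 14 (.lit 0) s).frame
  have hsI : HoldsInput d G w T r X s₁ := hs.frame hF₁ (by decide)
  have hLI : HoldsItems (items G X d n) s₁ := hL.frame hF₁ (by decide)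
  refine Run.count hZ (fun m s' => s'.nvar 14 = m * n ∧ SameOutside n (q * n) s s' ∧
      ((∀ (i : ℕ) (hi : i < (items G X d n).length), IsChild T r t (items G X d n)[i].1 →
        IsSolved d G w T r X s i (items G X d n)[i]) →
      IsOptimalExtension G d w (verticesBelowPart T r X t {t' | (t' : ℕ) < m}) (X t) f
        (row n s' q))) N 1 le_rfl hNZ
    ?_ (fun _ _ => rfl) (by decide) (fun _ _ _ h => h)
    ⟨by simp [hs₁, State.setN, NExp.eval], fun _ _ => rfl, fun _ => ?_⟩ ?_ ?_
  · intro s' hF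
    exact (hF.nvar 2 (by decide)).trans (hsI.nodes.trans (mul_one N).symm)
  · have : row n s₁ q = f := hrow
    have hempty : {t' : Fin N | (t' : ℕ) < 0} = ∅ := by simp
    change IsOptimalExtension G d w _ (X t) f (row n s₁ q)
    rw [this, hempty, verticesBelowPart_empty]
    exact isOptimalExtension_self hf hfX
  · rintro m hm s' hF h13 ⟨h14, hsame, hopt⟩
    have hs' := hsI.frame hF (by decide)
    have hL' := hLI.frame hF (by decide)
    have e₁ : s'.nvar 8 = q * n := (hF.nvar 8 (by decide)).trans ((hF₁.nvar 8 (by decide)).trans h8)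
    have e₂ : s'.nvar 15 = t * n :=
      (hF.nvar 15 (by decide)).trans ((hF₁.nvar 15 (by decide)).trans h15)
    have e₃ : s'.nvar 16 = t * N :=
      (hF.nvar 16 (by decide)).trans ((hF₁.nvar 16 (by decide)).trans h16)
    have e₄ : s'.rarr 1 = s.rarr 1 := hF.rarr 1 (by decide)
    have hchild := hs'.child t ⟨m, hm⟩
    dsimp only at hchild
    have hadd : ∀ s'' : State, s''.nvar 14 = m * n → s''.nvar 1 = n →
        NExp.eval s'' (.add (.var 14) (.var 1)) = (m + 1) * n := fun s'' h h' => by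
      simp [NExp.eval, h, h', add_mul]
    rw [insert_setOf_lt hm]
    refine Run.seq hZ (Run.ite hZ (fun hb => ?_) (fun hb => Run.skip (Run.setN ?_)))
    · simp only [BExp.Holds, NExp.eval, e₃, h13, mul_one, hchild] at hb
      -- A compatible child item always exists: `f` restricted to the bag of the child.
      have hex : ∃ (p : ℕ) (hp : p < (items G X d n).length), (items G X d n)[p].1 = ⟨m, hm⟩ ∧
          AgreeOnBags X t ⟨m, hm⟩ (items G X d n)[p].2 (items G X d n)[q].2 := by
        have hmem : ((⟨m, hm⟩ : Fin N), restrictTo (X ⟨m, hm⟩) f) ∈ items G X d n :=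
          mem_items.2 ⟨hf.restrictTo _, fun v hv => ⟨mem_of_restrictTo_ne_zero hv, v.2⟩⟩
        obtain ⟨p, hp, hpe⟩ := List.getElem_of_mem hmem
        refine ⟨p, hp, by rw [hpe], fun v _ hv => ?_⟩
        rw [hpe, hqt]
        exact restrictTo_of_mem hv
      refine Run.seq hZ ((run_findProg hZ hnZ hn hLZ hs' hL' hq e₁ h14 e₂ hex).mono_frame ?_)
      rintro s₂ hF₂ ⟨b, hbL, h17, hbt, hba, hbest⟩
      have hbq : b ≠ q := by
        rintro rfl
        rw [hqt] at hbt
        exact hb.1.ne hbt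
      refine (run_mergeProg hZ hnZ (hs'.frame hF₂ (by decide)) hbq
        ((hF₂.nvar 8 (by decide)).trans e₁) h17).mono_frame ?_
      rintro s₃ hF₃ ⟨hrow₃, hsame₃⟩
      have h7 : s₂.narr 7 = s'.narr 7 := hF₂.narr 7 (by decide)
      have hrow₂ : ∀ i, row n s₂ i = row n s' i := fun i => by
        unfold row
        rw [h7]
      refine Run.setN ⟨?_, fun a ha => ?_, fun hsol => ?_⟩
      · rw [hadd s₃ ((hF₃.nvar 14 (by decide)).trans ((hF₂.nvar 14 (by decide)).trans h14))
          ((hF₃.nvar 1 (by decide)).trans (hs'.frame hF₂ (by decide)).vertices)]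
        simp [State.setN]
      · exact (hsame₃ a ha).trans ((congr_fun h7 a).trans (hsame a ha))
      · change IsOptimalExtension G d w _ (X t) f (row n s₃ q)
        have hsol' : ∀ (i : ℕ) (hi : i < (items G X d n).length),
            (items G X d n)[i].1 = ⟨m, hm⟩ →
            IsOptimalExtension G d w (verticesBelow T r X ⟨m, hm⟩) (X ⟨m, hm⟩)
              (items G X d n)[i].2 (row n s' i) ∧
            s'.rarr 1 (i * n) = coloredWeight w (row n s' i) := fun i hi hit => by
          have := hsol i hi (hit ▸ hb)
          rw [IsSolved, hit] at this
          rwa [hsame.row_eq (i := i), e₄]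
          rintro rfl
          rw [hqt] at hit
          exact hb.1.ne hit
        rw [hrow₃, hrow₂, hrow₂]
        rw [hqt] at hba hbest
        refine (hopt hsol).overlay_child hD hb (by simp) (hsol' b hbL hbt).1 hba
          fun g' hg' hgX hga => ?_
        -- Every competitor `g'` on the bag of the child is itself an item, so the search has
        -- compared it with the chosen one.
        have hmem : ((⟨m, hm⟩ : Fin N), g') ∈ items G X d n :=
          mem_items.2 ⟨hg', fun v hv => ⟨hgX v hv, v.2⟩⟩
        obtain ⟨p, hp, hpe⟩ := List.getElem_of_mem hmem
        have hp' := hsol' p hp (by rw [hpe])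
        have hle := hbest p hp (by rw [hpe]) (by rw [hpe]; exact hga)
        rw [hp'.2, (hsol' b hbL hbt).2] at hle
        refine ⟨row n s' p, ?_, hle⟩
        have := hp'.1
        rwa [hpe] at this
    · simp only [BExp.Holds, NExp.eval, e₃, h13, mul_one, hchild] at hb
      refine ⟨?_, hsame, fun hsol => ?_⟩
      · rw [hadd s' h14 hs'.vertices]
        simp [State.setN]
      · rw [verticesBelowPart_insert_of_not_isChild hb]
        exact hopt hsol
  · rintro s' hF ⟨-, hsame, hopt⟩
    have : {t' : Fin N | (t' : ℕ) < N} = Set.univ := Set.eq_univ_of_forall fun t' => t'.2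
    rw [this, verticesBelowPart_univ] at hopt
    exact ⟨hsame, hopt⟩

theorem run_processProg (hD : IsTreeDecomposition G T X) (hZ : 1 ≤ Z) (hnZ : n ≤ Z)
    (hNZ : N ≤ Z) (hn : 1 ≤ n) (hLZ : (items G X d n).length ≤ Z) {s : State}
    (hs : HoldsInput d G w T r X s) (hL : HoldsItems (items G X d n) s) {q : ℕ}
    (hq : q < (items G X d n).length) (h8 : s.nvar 8 = q * n) :
    Run Z processProg s fun s' => SameOutside n (q * n) s s' ∧
      (∀ a ≠ q * n, s'.rarr 1 a = s.rarr 1 a) ∧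
      ((∀ (i : ℕ) (hi : i < (items G X d n).length),
        IsChild T r (items G X d n)[q].1 (items G X d n)[i].1 →
        IsSolved d G w T r X s i (items G X d n)[i]) →
      IsSolved d G w T r X s' q (items G X d n)[q]) := by
  rcases hqt : (items G X d n)[q] with ⟨t, f⟩
  refine Run.seq hZ (Run.setN ?_)
  have hF₁ := (Exec.setN 15 (.get 5 (.var 8)) s).frame
  have h15 : (s.setN 15 (NExp.eval s (.get 5 (.var 8)))).nvar 15 = t * n := by
    simp [State.setN, NExp.eval, h8, hL.node q hq, hqt]
  generalize s.setN 15 (NExp.eval s (.get 5 (.var 8))) = s₁ at hF₁ h15 ⊢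
  have hs₁ : HoldsInput d G w T r X s₁ := hs.frame hF₁ (by decide)
  have hL₁ : HoldsItems (items G X d n) s₁ := hL.frame hF₁ (by decide)
  have h8₁ : s₁.nvar 8 = q * n := (hF₁.nvar 8 (by decide)).trans h8
  refine Run.seq hZ (Run.setN ?_)
  have hF₂ := (Exec.setN 16 (.get 6 (.var 8)) s₁).frame
  have h16 : (s₁.setN 16 (NExp.eval s₁ (.get 6 (.var 8)))).nvar 16 = t * N := by
    simp [State.setN, NExp.eval, h8₁, hL₁.node' q hq, hqt]
  generalize s₁.setN 16 (NExp.eval s₁ (.get 6 (.var 8))) = s₂ at hF₂ h16 ⊢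
  have hs₂ : HoldsInput d G w T r X s₂ := hs₁.frame hF₂ (by decide)
  have hL₂ : HoldsItems (items G X d n) s₂ := hL₁.frame hF₂ (by decide)
  have h8₂ : s₂.nvar 8 = q * n := (hF₂.nvar 8 (by decide)).trans h8₁
  have h15₂ : s₂.nvar 15 = t * n := (hF₂.nvar 15 (by decide)).trans h15
  have h7₂ : s₂.narr 7 = s.narr 7 := (hF₂.narr 7 (by decide)).trans (hF₁.narr 7 (by decide))
  have hr₂ : s₂.rarr 1 = s.rarr 1 := (hF₂.rarr 1 (by decide)).trans (hF₁.rarr 1 (by decide))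
  refine Run.seq hZ ((run_copyProg hZ hnZ hs₂ hL₂ hq h8₂).mono_frame ?_)
  rintro s₃ hF₃ ⟨hrow₃, hsame₃⟩
  rw [hqt] at hrow₃
  have hs₃ : HoldsInput d G w T r X s₃ := hs₂.frame hF₃ (by decide)
  have hr₃ : s₃.rarr 1 = s.rarr 1 := (hF₃.rarr 1 (by decide)).trans hr₂
  have h8₃ : s₃.nvar 8 = q * n := (hF₃.nvar 8 (by decide)).trans h8₂
  have hsame₃' : SameOutside n (q * n) s s₃ := fun a ha => (hsame₃ a ha).trans (congr_fun h7₂ a)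
  refine Run.seq hZ ((run_childrenProg hD hZ hnZ hNZ hn hLZ hs₃ (hL₂.frame hF₃ (by decide)) hq hqt
    h8₃ ((hF₃.nvar 15 (by decide)).trans h15₂) ((hF₃.nvar 16 (by decide)).trans h16)
    hrow₃).mono_frame ?_)
  rintro s₄ hF₄ ⟨hsame₄, hopt⟩
  refine (run_weighProg hZ hnZ (hs₃.frame hF₄ (by decide))
    ((hF₄.nvar 8 (by decide)).trans h8₃)).mono_frame ?_
  rintro s₅ hF₅ ⟨hw, hrest⟩
  have h7₅ : s₅.narr 7 = s₄.narr 7 := hF₅.narr 7 (by decide)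
  have hr₄ : s₄.rarr 1 = s.rarr 1 := (hF₄.rarr 1 (by decide)).trans hr₃
  refine ⟨fun a ha => ?_, fun a ha => ?_, fun hsol => ⟨?_, hw⟩⟩
  · rw [h7₅, hsame₄ a ha, hsame₃' a ha]
  · rw [hrest a ha, hr₄]
  · have : row n s₅ q = row n s₄ q := by
      unfold row
      rw [h7₅]
    rw [this]
    refine hopt fun i hi hit => ?_
    have hiq : i ≠ q := by
      rintro rfl
      rw [hqt] at hit
      exact hit.1.ne rfl
    have := hsol i hi hit
    rwa [IsSolved, hsame₃'.row_eq hiq, hr₃]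

theorem run_solveProg (hD : IsTreeDecomposition G T X) (hZ : 1 ≤ Z) (hnZ : n ≤ Z)
    (hNZ : N ≤ Z) (hn : 1 ≤ n) (hLZ : (items G X d n).length ≤ Z) {s : State}
    (hs : HoldsInput d G w T r X s) (hL : HoldsItems (items G X d n) s) :
    Run Z solveProg s fun s' => ∀ (i : ℕ) (hi : i < (items G X d n).length),
      IsSolved d G w T r X s' i (items G X d n)[i] := by
  -- After `h` rounds the items of the nodes of depth at least `N - h` are solved. Depths are less
  -- than `N`, so nothing is claimed at `h = 0`, and everything at `h = N`.
  refine Run.count hZ (fun h s' => ∀ (i : ℕ) (hi : i < (items G X d n).length),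
      N ≤ T.dist r (items G X d n)[i].1 + h → IsSolved d G w T r X s' i (items G X d n)[i])
    N 1 le_rfl hNZ ?_ (fun _ _ => rfl) (by decide) (fun _ _ _ h => h) ?_ ?_
    (fun s' _ h i hi => h i hi (Nat.le_add_left _ _))
  · intro s' hF
    exact (hF.nvar 2 (by decide)).trans (hs.nodes.trans (mul_one N).symm)
  · intro i hi h
    have := hD.isTree.dist_lt_card (r := r) (items G X d n)[i].1
    rw [Fintype.card_fin] at this
    omega
  · rintro h hh s₁ hF₁ - hI
    have hs₁ := hs.frame hF₁ (by decide)
    have hL₁ := hL.frame hF₁ (by decide)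
    -- Items are overwritten in place, so what earlier rounds achieved is carried along: a solved
    -- item is solved again from its deeper children, and other rows are untouched.
    refine Run.count hZ (fun m s' => (∀ (i : ℕ) (hi : i < (items G X d n).length),
        N ≤ T.dist r (items G X d n)[i].1 + h → IsSolved d G w T r X s' i (items G X d n)[i]) ∧
        ∀ (i : ℕ) (hi : i < (items G X d n).length), i < m →
        N ≤ T.dist r (items G X d n)[i].1 + (h + 1) →
          IsSolved d G w T r X s' i (items G X d n)[i])
      (items G X d n).length n hn hLZ ?_ ?_ (by decide) (fun _ _ _ h => h) ⟨hI, by simp⟩ ?_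
      (fun s' _ h i hi => h.2 i hi hi)
    · intro s' hF
      exact (hF.nvar 6 (by decide)).trans hL₁.length
    · intro s' hF
      exact (hF.nvar 1 (by decide)).trans hs₁.vertices
    · rintro q hq s₂ hF₂ h8 ⟨hI₁, hI₂⟩
      refine (run_processProg hD hZ hnZ hNZ hn hLZ (hs₁.frame hF₂ (by decide))
        (hL₁.frame hF₂ (by decide)) hq h8).mono ?_
      rintro s₃ ⟨hsame, hrest, hsol⟩
      have hkeep : ∀ (i : ℕ) (hi : i < (items G X d n).length), i ≠ q →
          IsSolved d G w T r X s₂ i (items G X d n)[i] →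
          IsSolved d G w T r X s₃ i (items G X d n)[i] := fun i hi hiq h => by
        rwa [IsSolved, hsame.row_eq hiq, hrest _ (by rwa [Ne, Nat.mul_left_inj (by omega)])]
      have hnew : N ≤ T.dist r (items G X d n)[q].1 + (h + 1) →
          IsSolved d G w T r X s₃ q (items G X d n)[q] := fun hq' =>
        hsol fun i hi hc => hI₁ i hi (by rw [hc.2]; omega)
      refine ⟨fun i hi hi' => ?_, fun i hi him hi' => ?_⟩
      · by_cases hiq : i = q
        · subst hiq
          exact hnew (by omega)
        · exact hkeep i hi hiq (hI₁ i hi hi')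
      · by_cases hiq : i = q
        · subst hiq
          exact hnew hi'
        · exact hkeep i hi hiq (hI₂ i hi (by omega) hi')

theorem run_outputProg (hZ : 1 ≤ Z) (hnZ : n ≤ Z) (hNZ : N ≤ Z) {s : State}
    (hs : HoldsInput d G w T r X s) (h3 : ∀ a, s.narr 3 a = 0) :
    Run Z outputProg s fun s' => outputSet n s' = Finset.univ.filter fun v => row n s r v ≠ 0 := by
  refine Run.seq hZ (Run.setN (Run.seq hZ ?_))
  have hF₁ := (Exec.setN 19 (.lit 0) s).frame
  have h19 : (s.setN 19 (NExp.eval s (.lit 0))).nvar 19 = 0 := by simp [State.setN, NExp.eval]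
  generalize s.setN 19 (NExp.eval s (.lit 0)) = s₁ at hF₁ h19 ⊢
  have hs₁ : HoldsInput d G w T r X s₁ := hs.frame hF₁ (by decide)
  refine Run.count hZ (fun m s' => s'.nvar 19 = m * n) r 1 le_rfl (r.2.le.trans hNZ)
    ?_ (fun _ _ => rfl) (by decide) (fun _ _ _ h => h) (by simpa using h19) ?_ ?_
  · intro s' hF
    exact (hF.nvar 3 (by decide)).trans (hs₁.root.trans (mul_one (r : ℕ)).symm)
  · rintro m hm s' hF - h
    refine Run.setN ?_
    simp [State.setN, NExp.eval, h, hF.nvar 1 (by decide), hs₁.vertices, add_mul]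
  · rintro s₂ hF₂ h
    have hs₂ := hs₁.frame hF₂ (by decide)
    have h7₂ : s₂.narr 7 = s.narr 7 := (hF₂.narr 7 (by decide)).trans (hF₁.narr 7 (by decide))
    have h3₂ : s₂.narr 3 = s.narr 3 := (hF₂.narr 3 (by decide)).trans (hF₁.narr 3 (by decide))
    refine Run.count hZ (fun m s' => (∀ v : Fin n, (v : ℕ) < m →
        (s'.narr 3 v = 1 ↔ row n s r v ≠ 0)) ∧ ∀ a, m ≤ a → s'.narr 3 a = 0) n 1 le_rfl hnZ
      ?_ (fun _ _ => rfl) (by decide) (fun _ _ _ h => h) ⟨by simp, fun a _ => ?_⟩ ?_ ?_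
    · intro s' hF
      exact (hF.nvar 1 (by decide)).trans (hs₂.vertices.trans (mul_one n).symm)
    · exact (congr_fun h3₂ a).trans (h3 a)
    · rintro m hm s₃ hF₃ h11 ⟨hI₁, hI₂⟩
      have e₁ := (hF₃.nvar 19 (by decide)).trans h
      have e₂ := (hF₃.narr 7 (by decide)).trans h7₂
      have hrow : s.narr 7 (r * n + m) = row n s r ⟨m, hm⟩ := rfl
      simp only [forall_fin_lt_succ hm]
      refine Run.ite hZ (fun hb => Run.skip ⟨⟨hI₁, ?_⟩, fun a ha => hI₂ a (by omega)⟩)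
        (fun hb => Run.putN ⟨⟨fun v hv => ?_, ?_⟩, fun a ha => ?_⟩)
      · simp only [BExp.Holds, NExp.eval, e₁, e₂, h11, mul_one, hrow] at hb
        simp [hb, hI₂ m le_rfl]
      · simp only [State.putN, NExp.eval, h11, mul_one, Function.update_self]
        rw [Function.update_of_ne (by omega)]
        exact hI₁ v hv
      · simp only [BExp.Holds, NExp.eval, e₁, e₂, h11, mul_one, hrow] at hb
        simp [State.putN, NExp.eval, h11, hb]
      · simp only [State.putN, NExp.eval, h11, mul_one, Function.update_self]
        rw [Function.update_of_ne (by omega)]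
        exact hI₂ a (by omega)
    · rintro s₃ - ⟨hI₁, -⟩
      ext v
      simp [outputSet, hI₁ v v.2]

theorem run_capProg (hZ : 1 ≤ Z) {s : State} (hs : HoldsInput d G w T r X s) :
    Run Z capProg s fun s' => HoldsInput (min d n) G w T r X s' ∧
      s'.nvar 6 = s.nvar 6 ∧ s'.nvar 16 = s.nvar 16 ∧ s'.narr = s.narr := by
  refine Run.ite hZ (fun hb => Run.skip ?_) (fun hb => Run.setN ?_)
  · simp only [BExp.Holds, NExp.eval, hs.colors, hs.vertices] at hb
    rw [min_eq_left hb]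
    exact ⟨hs, rfl, rfl, rfl⟩
  · simp only [BExp.Holds, NExp.eval, hs.colors, hs.vertices, not_le] at hb
    rw [min_eq_right hb.le]
    refine ⟨⟨?_, hs.vertices, hs.nodes, hs.root, hs.adj, hs.child, hs.bag, hs.weight⟩, rfl, rfl,
      rfl⟩
    simp [State.setN, NExp.eval, hs.vertices]

theorem holdsInput_inputState : HoldsInput d G w T r X (inputState d G w T r X) where
  colors := rfl
  vertices := rfl
  nodes := rfl
  root := rfl
  adj := matrixOf_eq_one_iff
  child := matrixOf_eq_one_iff
  bag := matrixOf_eq_one_iff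
  weight v := by simp [inputState]

theorem run_mainProg (hD : IsTreeDecomposition G T X) (hr : X r = ∅) (hZ : 1 ≤ Z) (hnZ : n ≤ Z)
    (hNZ : N ≤ Z) (hn : 1 ≤ n) (hLZ : (items G X (min d n) n).length ≤ Z) :
    Run Z mainProg (inputState d G w T r X) fun s =>
      IsMaxWeightColorable d G w (outputSet n s) := by
  refine Run.seq hZ ((run_capProg hZ holdsInput_inputState).mono ?_)
  rintro s₁ ⟨hs₁, h6, h16, harr⟩
  refine Run.seq hZ ((run_initProg hZ hNZ hn hs₁ (h6.trans rfl) (h16.trans rfl)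
    fun a => by rw [harr]; rfl).mono_frame fun s₂ hF₂ hL₂ => ?_)
  have hs₂ := hs₁.frame hF₂ (by decide)
  refine Run.seq hZ ((run_itemsProg hZ hnZ ((min_le_right d n).trans hnZ) hLZ hs₂ hL₂).mono_frame
    fun s₃ hF₃ hL₃ => ?_)
  have hs₃ := hs₂.frame hF₃ (by decide)
  refine Run.seq hZ ((run_solveProg hD hZ hnZ hNZ hn hLZ hs₃ hL₃).mono_frame
    fun s₄ hF₄ hsol => ?_)
  have h3 : ∀ a, s₄.narr 3 a = 0 := fun a => by
    rw [hF₄.narr 3 (by decide), hF₃.narr 3 (by decide), hF₂.narr 3 (by decide), harr]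
    rfl
  refine (run_outputProg hZ hnZ hNZ (hs₃.frame hF₄ (by decide)) h3).mono fun s₅ hout => ?_
  rw [hout]
  have hr0 : (r : ℕ) < (items G X (min d n) 0).length := by simp [items]
  have hpre := items_zero_prefix (G := G) (X := X) (d := min d n) n
  -- The item of index `r` is the root with the empty coloring. Its bag is empty and all vertices
  -- lie below it, so its best extension is a global optimum.
  have hri : (items G X (min d n) n)[(r : ℕ)]'(hr0.trans_le hpre.length_le) = (r, fun _ => 0) := by
    rw [← hpre.getElem hr0]
    simp [items]
  have h := (hsol r (hr0.trans_le hpre.length_le)).1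
  rw [hri, verticesBelow_root hD, hr] at h
  refine IsMaxWeightColorable.of_min_card ?_
  rw [Fintype.card_fin]
  exact isMaxWeightColorable_of_isOptimalExtension h

end Correctness

/-! ### The running time -/

/-- For `n ≥ 2` the base is at most `n ^ 3`. For `n = 1` no power of `n` helps, but the capped
exponent is at most `1`, which gives the constant `4`. -/
theorem two_mul_add_one_pow_min_le {n : ℕ} (hn : 1 ≤ n) (d : ℕ) :
    (2 * (n + 1)) ^ min d n ≤ 4 * n ^ (3 * d) := by
  rcases hn.eq_or_lt with rfl | hn
  · calc (2 * (1 + 1)) ^ min d 1 ≤ (2 * (1 + 1)) ^ 1 :=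
        Nat.pow_le_pow_right (by norm_num) (min_le_right _ _)
      _ ≤ _ := by simp
  · have h : 2 * (n + 1) ≤ n ^ 3 := by
      have : n ^ 3 = n * n * n := by ring
      nlinarith [Nat.mul_le_mul hn hn]
    calc (2 * (n + 1)) ^ min d n ≤ (n ^ 3) ^ min d n := Nat.pow_le_pow_left h _
      _ ≤ (n ^ 3) ^ d := Nat.pow_le_pow_right (by positivity) (min_le_left _ _)
      _ = n ^ (3 * d) := (pow_mul _ _ _).symm
      _ ≤ _ := Nat.le_mul_of_pos_left _ (by norm_num)

/-- Here `√(2k) ≤ 2√k`, and the logarithm is at least `1` because `d ≥ 1`. -/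
theorem two_pow_sqrt_mul_le (k : ℕ) {d e : ℕ} (hd : 1 ≤ d) (he : e ≤ d) :
    (2 : ℝ) ^ (Nat.sqrt (2 * k) * e) ≤ 2 ^ (2 * √(k : ℝ) * d * Real.logb 2 (d + 1)) := by
  rw [← Real.rpow_natCast]
  refine Real.rpow_le_rpow_of_exponent_le one_le_two ?_
  have hd' : (1 : ℝ) ≤ d := by exact_mod_cast hd
  have hlog : 1 ≤ Real.logb 2 ((d : ℝ) + 1) := by
    rw [Real.le_logb_iff_rpow_le one_lt_two (by positivity), Real.rpow_one]
    linarith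
  have hsqrt : (Nat.sqrt (2 * k) : ℝ) ≤ 2 * √(k : ℝ) := by
    refine Real.nat_sqrt_le_real_sqrt.trans ?_
    rw [Real.sqrt_le_left (by positivity), mul_pow, Real.sq_sqrt (by positivity)]
    push_cast
    linarith [(Nat.cast_nonneg k : (0 : ℝ) ≤ k)]
  calc ((Nat.sqrt (2 * k) * e : ℕ) : ℝ) = (Nat.sqrt (2 * k) : ℝ) * e := by push_cast; rfl
    _ ≤ 2 * √(k : ℝ) * d := by gcongr
    _ ≤ _ := le_mul_of_one_le_right (by positivity) hlog

theorem running_time_le {c d n N k a e t Z C : ℕ} (hd : 1 ≤ d) (hn : 1 ≤ n) (hN : N ≤ c * n ^ c)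
    (hZ : Z = ((n + 1) * 2 ^ (Nat.sqrt (2 * k) + 1)) ^ min d n * N * n) (ht : t ≤ a * Z ^ e)
    (hC : C = a * (4 * c) ^ e + (c + 4) * e + 2 * e) :
    (t : ℝ) ≤ (C : ℝ) * (2 : ℝ) ^ ((C : ℝ) * √(k : ℝ) * (d : ℝ) * Real.logb 2 ((d : ℝ) + 1))
      * (n : ℝ) ^ (C * d) := by
  set E : ℝ := √(k : ℝ) * d * Real.logb 2 (d + 1) with hE
  have hE0 : 0 ≤ E := by
    have : 0 ≤ Real.logb 2 ((d : ℝ) + 1) :=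
      Real.logb_nonneg one_lt_two (by linarith [(Nat.cast_nonneg d : (0 : ℝ) ≤ d)])
    positivity
  have hn' : (1 : ℝ) ≤ n := by exact_mod_cast hn
  -- The extra factor `2` from the exponent `√(2k) + 1` joins `n + 1`; finally `3 * d + c + 1 ≤ (c +
  -- 4) * d` because `d ≥ 1`.
  have hZ₁ : Z ≤ 4 * c * n ^ ((c + 4) * d) * 2 ^ (Nat.sqrt (2 * k) * min d n) := by
    calc Z = (2 * (n + 1)) ^ min d n * 2 ^ (Nat.sqrt (2 * k) * min d n) * N * n := by
          rw [hZ, pow_mul, ← mul_pow]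
          ring_nf
      _ ≤ (4 * n ^ (3 * d)) * 2 ^ (Nat.sqrt (2 * k) * min d n) * (c * n ^ c) * n := by
          gcongr
          exact two_mul_add_one_pow_min_le hn d
      _ = 4 * c * n ^ (3 * d + c + 1) * 2 ^ (Nat.sqrt (2 * k) * min d n) := by ring
      _ ≤ _ := by
          gcongr
          nlinarith
  have hZ₂ : (Z : ℝ) ≤ 4 * c * n ^ ((c + 4) * d) * 2 ^ (2 * E) := by
    have h₁ : (Z : ℝ) ≤ 4 * c * n ^ ((c + 4) * d) * 2 ^ (Nat.sqrt (2 * k) * min d n) := by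
      exact_mod_cast hZ₁
    refine h₁.trans ?_
    have h₂ := two_pow_sqrt_mul_le k hd (min_le_left d n)
    have h₃ : 2 * √(k : ℝ) * d * Real.logb 2 (d + 1) = 2 * E := by rw [hE]; ring
    rw [h₃] at h₂
    gcongr
  have hpow : ((2 : ℝ) ^ (2 * E)) ^ e = 2 ^ ((2 * e : ℕ) * E) := by
    rw [← Real.rpow_natCast, ← Real.rpow_mul two_pos.le]
    push_cast
    ring_nf
  have hCE : (C : ℝ) * √(k : ℝ) * d * Real.logb 2 (d + 1) = C * E := by rw [hE]; ring
  rw [hCE]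
  calc (t : ℝ) ≤ a * (Z : ℝ) ^ e := by exact_mod_cast ht
    _ ≤ a * (4 * c * n ^ ((c + 4) * d) * 2 ^ (2 * E)) ^ e := by gcongr
    _ = (a * (4 * c) ^ e : ℕ) * 2 ^ ((2 * e : ℕ) * E) * (n : ℝ) ^ ((c + 4) * e * d) := by
        rw [mul_pow, mul_pow, hpow]
        push_cast
        ring
    -- Each summand of `C` dominates one of the three factors: the constant, the exponent of `2`,
    -- the exponent of `n`.
    _ ≤ _ := by
        gcongr
        · omega
        · exact one_le_two
        · omega
        · omega

theorem mainTheorem1 :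
    ∃ P : RAM.Prog, ∀ c : ℕ, ∃ C : ℕ,
      ∀ (d n N k : ℕ) (G : SimpleGraph (Fin n)) (w : Fin n → ℝ)
        (T : SimpleGraph (Fin N)) (r : Fin N) (X : Fin N → Set (Fin n)),
        1 ≤ d → IsTreeDecomposition G T X → IsNice T r X → IsAlmostChordal k G X →
        N ≤ c * n ^ c →
        ∃ (t : ℕ) (s : RAM.State),
          RAM.Exec P (inputState d G w T r X) t s ∧
          IsMaxWeightColorable d G w (outputSet n s) ∧
          (t : ℝ) ≤ (C : ℝ) * (2 : ℝ) ^ ((C : ℝ) * √(k : ℝ) * (d : ℝ) * Real.logb 2 ((d : ℝ) + 1))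
            * (n : ℝ) ^ (C * d) := by
  refine ⟨RAM.mainProg, fun c => ⟨RAM.mainProg.coeff * (4 * c) ^ RAM.mainProg.depth +
    (c + 4) * RAM.mainProg.depth + 2 * RAM.mainProg.depth,
    fun d n N k G w T r X hd hD hnice hk hN => ?_⟩⟩
  have hN₀ : 1 ≤ N := r.pos
  -- For `n = 0` the bound `c * n ^ c` is `0`, also when `c = 0`, although the tree has the node
  -- `r`.
  have hn : 1 ≤ n := by
    by_contra h
    obtain rfl : n = 0 := by omega
    rcases Nat.eq_zero_or_pos c with rfl | hc
    · omega
    · rw [Nat.zero_pow hc] at hN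
      omega
  -- The bound on the number of items, times `n`, so that `Z` exceeds neither the range of loops
  -- over items nor falls below `n` or `N`.
  obtain ⟨Z, hZ⟩ : ∃ Z, Z = ((n + 1) * 2 ^ (Nat.sqrt (2 * k) + 1)) ^ min d n * N * n := ⟨_, rfl⟩
  have hB : 1 ≤ ((n + 1) * 2 ^ (Nat.sqrt (2 * k) + 1)) ^ min d n :=
    Nat.pos_of_ne_zero (by positivity)
  have hLZ : (items G X (min d n) n).length ≤ Z :=
    (length_items_le hk n).trans (hZ ▸ Nat.le_mul_of_pos_right _ hn)
  have hnZ : n ≤ Z := hZ ▸ Nat.le_mul_of_pos_left _ (Nat.mul_pos hB hN₀)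
  have hNZ : N ≤ Z := hZ ▸ (Nat.le_mul_of_pos_left _ hB).trans (Nat.le_mul_of_pos_right _ hn)
  obtain ⟨t, s, hexec, ht, hmax⟩ :=
    run_mainProg (d := d) (w := w) hD hnice.root_empty (hn.trans hnZ) hnZ hNZ hn hLZ
  exact ⟨t, s, hexec, hmax, running_time_le hd hn hN hZ ht rfl⟩
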